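/- Work in the ring $\Lambda$ of symmetric functions over $\mathbb Q(t)$, with the Hall scalar product $\langle s_\lambda,s_\mu\rangle=\delta_{\lambda\mu}$; $f^\perp$ is the adjoint of multiplication by $f$, and $f\mapsto f[X(t-1)]$, $f\mapsto f[X/(1-t)]$ are the algebra maps with $p_k\mapsto (t^k-1)p_k$ and $p_k\mapsto p_k/(1-t^k)$. Let $\le$ denote the dominance order on partitions of the same size. For $\ell\in\mathbb Z$ put $$B_\ell=\sum_{i\ge 0}s_{i+\ell}[X]\,s_i[X(t-1)]^\perp ,\qquad s_r=h_r,\quad h_r=0\text{ for } r<0,$$ and for a partition $\lambda$ with exactly $m$ (nonzero) parts $$B_\lambda=\prod_{1\le i<j\le m}(1-te_{ij})\,B_{\lambda_1}\cdots B_{\lambda_m},$$ where $e_{ij}$ acts on the word $B_{\lambda_1}\cdots B_{\lambda_m}$ by raising the $i$-th index by $1$ and lowering the $j$-th index by $1$. For a finite sequence of partitions $S=(\lambda^{(1)},\dots,\lambda^{(r)})$ the generalized Schur product is $\mathcal H_S[X;t]=B_{\lambda^{(1)}}\cdots B_{\lambda^{(r)}}\cdot 1$. The sequence $S$ is dominant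 if the concatenation $\bar S$ of $\lambda^{(1)},\dots,\lambda^{(r)}$ is a partition. Let $H_\lambda[X;t]=Q_\lambda[X/(1-t);t]$ be the (modified) Hall–Littlewood polynomial, where $Q_\lambda[X;t]$ is the Hall–Littlewood $Q$-function: $Q_\lambda=b_\lambda(t)P_\lambda$, with $b_\lambda(t)=\prod_{k\ge1}\prod_{j=1}^{m_k(\lambda)}(1-t^j)$, $m_k(\lambda)$ the number of parts of $\lambda$ equal to $k$, and $P_\lambda\in s_\lambda+\sum_{\mu<\lambda}\mathbb Q(t)s_\mu$ orthogonal for $\langle p_\lambda,p_\mu\rangle_t=\delta_{\lambda\mu}z_\lambda\prod_i(1-t^{\lambda_i})^{-1}$. Let $S$ be a dominant sequence of partitions with $\bar S=\lambda\vdash n$. Then: 1. $\mathcal H_S$ has a unique expansion $\mathcal H_S[X;t]=\sum_{\mu\vdash n}K_{\mu;S}(t)\,s_\mu[X]$ with coefficients in $\mathbb Q(t)$. These coefficients lie in $\mathbb Z[t]$, $K_{\lambda;S}(t)=1$, and $K_{\mu;S}(t)=0$ whenever $\mu\not\ge\lambda$; that is, $$\mathcal H_S[X;t]=s_\lambda[X]+\sum_{\mu>\lambda}K_{\mu;S}(t)\,s_\mu[X],\qquad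 K_{\mu;S}(t)\in\mathbb Z[t].$$ 2. $\mathcal H_S$ has a unique expansion $\mathcal H_S[X;t]=\sum_{\mu\vdash n}C_{\mu;S}(t)\,H_\mu[X;t]$ with coefficients in $\mathbb Q(t)$. These coefficients lie in $\mathbb Z[t]$, $C_{\lambda;S}(t)=1$, and $C_{\mu;S}(t)=0$ whenever $\mu\not\ge\lambda$; that is, $$\mathcal H_S[X;t]=H_\lambda[X;t]+\sum_{\mu>\lambda}C_{\mu;S}(t)\,H_\mu[X;t],\qquad C_{\mu;S}(t)\in\mathbb Z[t].$$ -/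

import Mathlib

open scoped Polynomial Nat

noncomputable section

namespace GenSchur

/-! ### Partitions -/

/-- A partition, written as the weakly decreasing list of its (nonzero) parts. -/
def IsPartition (l : List ℕ) : Prop := l.SortedGE ∧ ∀ a ∈ l, 0 < a

/-- The parts of `lam ⊢ n` in weakly decreasing order. -/
def rows {n : ℕ} (lam : n.Partition) : List ℕ := lam.parts.sort (· ≥ ·)

/-- Dominance order `lam ≤ mu` on the partitions of `n`. -/
def DomLE {n : ℕ} (lam mu : n.Partition) : Prop :=
  ∀ i : ℕ, ((rows lam).take i).sum ≤ ((rows mu).take i).sum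

/-- Strict dominance order `lam < mu`. -/
def DomLT {n : ℕ} (lam mu : n.Partition) : Prop := DomLE lam mu ∧ lam ≠ mu

theorem rows_injective {n : ℕ} : Function.Injective (rows (n := n)) := by
  intro a b h
  have h2 := congrArg (fun l : List ℕ => (l : Multiset ℕ)) h
  simp only [rows, Multiset.sort_eq] at h2
  exact Nat.Partition.ext h2

theorem isPartition_rows {n : ℕ} (lam : n.Partition) : IsPartition (rows lam) :=
  ⟨(Multiset.pairwise_sort lam.parts (· ≥ ·)).sortedGE,
    fun _ ha => lam.parts_pos ((Multiset.mem_sort _).1 ha)⟩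

/-- A list of positive numbers is determined by its partial sums. -/
theorem eq_of_take_sum_eq : ∀ (l₁ l₂ : List ℕ), (∀ a ∈ l₁, 0 < a) → (∀ a ∈ l₂, 0 < a) →
    (∀ i, (l₁.take i).sum = (l₂.take i).sum) → l₁ = l₂
  | [], [], _, _, _ => rfl
  | [], b :: l₂, _, h2, h => by
      have := h 1
      have := h2 b (by simp)
      simp at *
      omega
  | a :: l₁, [], h1, _, h => by
      have := h 1
      have := h1 a (by simp)
      simp at *
      omega
  | a :: l₁, b :: l₂, h1, h2, h => by
      have hab : a = b := by simpa using h 1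
      subst hab
      congr 1
      refine eq_of_take_sum_eq l₁ l₂ (fun x hx => h1 x (by simp [hx]))
        (fun x hx => h2 x (by simp [hx])) fun i => ?_
      simpa using h (i + 1)

theorem DomLE.antisymm {n : ℕ} {lam mu : n.Partition} (h : DomLE lam mu) (h' : DomLE mu lam) :
    lam = mu :=
  rows_injective (eq_of_take_sum_eq _ _ (isPartition_rows lam).2 (isPartition_rows mu).2
    fun i => le_antisymm (h i) (h' i))

theorem domLT_wf {n : ℕ} : WellFounded (DomLT (n := n)) := by
  have : IsTrans n.Partition DomLT := ⟨fun a b c hab hbc =>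
    ⟨fun i => (hab.1 i).trans (hbc.1 i), fun hac => hab.2 (hab.1.antisymm (hac ▸ hbc.1))⟩⟩
  have : Std.Irrefl (DomLT (n := n)) := ⟨fun a h => h.2 rfl⟩
  exact Finite.wellFounded_of_trans_of_irrefl _

open Classical in
/-- The finite set of all partitions `mu > lam` of the same size. -/
def above {n : ℕ} (lam : n.Partition) : Finset n.Partition := Finset.univ.filter (DomLT lam ·)

open Classical in
/-- The finite set of all partitions `mu < lam` of the same size. -/
def below {n : ℕ} (lam : n.Partition) : Finset n.Partition := Finset.univ.filter (DomLT · lam)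

/-! ### The ring of symmetric functions over `ℚ(t)` -/

/-- The coefficient field `ℚ(t)`. -/
abbrev Coef : Type := RatFunc ℚ

/-- The parameter `t`. -/
def t : Coef := RatFunc.X

/-- An integer polynomial, viewed as an element `P(t)` of `ℚ(t)`. -/
def evalT (P : ℤ[X]) : Coef := Polynomial.aeval t P

/-- The ring `Λ` of symmetric functions (in infinitely many variables) with coefficients in `ℚ(t)`:
the polynomial ring in the power sums `p₁, p₂, …`. -/
abbrev Sym : Type := MvPolynomial ℕ+ Coef

/-- The power sum `p_k`. -/
def p (k : ℕ+) : Sym := MvPolynomial.X k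

/-- The power sum monomial `p₁^{m₁} p₂^{m₂} ⋯`, i.e. `p_λ` for the partition `λ` with `m_k` parts
equal to `k`. -/
def pMon (m : ℕ+ →₀ ℕ) : Sym := MvPolynomial.monomial m 1

/-- The value `f(x_σ)` of a symmetric function in finitely many variables. -/
def inVars (σ : Type*) [Fintype σ] : Sym →ₐ[Coef] MvPolynomial σ Coef :=
  MvPolynomial.aeval fun k => MvPolynomial.psum σ Coef (k : ℕ)

/-- The complete symmetric function `h_r`, `r ≥ 0`, through `r h_r = ∑_{i=1}^r p_i h_{r-i}`; see
`inVars_hNat` for its expression as a sum of monomials in the variables. -/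
def hNat : ℕ → Sym
  | 0 => 1
  | r + 1 => MvPolynomial.C (1 / ((r : Coef) + 1)) *
      ∑ i : Fin (r + 1), p (Nat.succPNat i) * hNat (r - i)
termination_by r => r
decreasing_by omega

/-- `h_r` for `r ∈ ℤ`, with `h_r = 0` for `r < 0`. -/
def h (r : ℤ) : Sym := if 0 ≤ r then hNat r.toNat else 0

/-- The Schur function `s_λ` by the Jacobi–Trudi determinant `det (h_{λ_i + j - i})`.
In particular `s_{(r)} = h_r`. -/
def schurL (l : List ℕ) : Sym :=
  Matrix.det (Matrix.of fun i j : Fin l.length => h ((l.get i : ℤ) + (j : ℤ) - (i : ℤ)))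

/-- The Schur function of a partition of `n`. -/
def schur {n : ℕ} (lam : n.Partition) : Sym := schurL (rows lam)

/-- The scalar product `⟨p_λ, p_μ⟩ = δ_{λμ} z_λ ∏_i w_{λ_i}`, with `z_λ = ∏_k k^{m_k} m_k!`. -/
def scalar (w : ℕ+ → Coef) : Sym →ₗ[Coef] Sym →ₗ[Coef] Coef :=
  (MvPolynomial.basisMonomials ℕ+ Coef).constr Coef fun m =>
    (MvPolynomial.basisMonomials ℕ+ Coef).constr Coef fun m' =>
      if m = m' then m.prod fun k a => ((k : ℕ) : Coef) ^ a * (a ! : Coef) * w k ^ a else 0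

/-- The Hall scalar product, for which the Schur functions are orthonormal:
`⟨p_λ, p_μ⟩ = δ_{λμ} z_λ`. -/
def hall : Sym →ₗ[Coef] Sym →ₗ[Coef] Coef := scalar fun _ => 1

/-- The Hall–Littlewood scalar product `⟨p_λ, p_μ⟩ = δ_{λμ} z_λ ∏_i 1/(1 - t^{λ_i})`
(the Macdonald scalar product at `q = 0`). -/
def scalarT : Sym →ₗ[Coef] Sym →ₗ[Coef] Coef := scalar fun k => 1 / (1 - t ^ (k : ℕ))

/-- Plethystic substitution `f ↦ f[X·c]`, given by `p_k[X·c] = p_k[X] p_k[c]`, where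
`c k` stands for `p_k[c]`. -/
def pleth (c : ℕ+ → Coef) : Sym →ₐ[Coef] Sym :=
  MvPolynomial.aeval fun k => MvPolynomial.C (c k) * p k

/-- `f ↦ f[X(t-1)]`. -/
def plethMul : Sym →ₐ[Coef] Sym := pleth fun k => t ^ (k : ℕ) - 1

/-- `f ↦ f[X/(1-t)]`. -/
def plethDiv : Sym →ₐ[Coef] Sym := pleth fun k => 1 / (1 - t ^ (k : ℕ))

/-- The operator `f^⊥` adjoint to multiplication by `f` for the Hall scalar product (see
`hall_perp`): bilinearly, `p_k^⊥ = k ∂/∂p_k`, so that `(p^m)^⊥ p^{m'}` is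
`∏_k k^{m_k} m'_k (m'_k - 1) ⋯ (m'_k - m_k + 1) · p^{m' - m}`. -/
def perp : Sym →ₗ[Coef] Sym →ₗ[Coef] Sym :=
  (MvPolynomial.basisMonomials ℕ+ Coef).constr Coef fun m =>
    (MvPolynomial.basisMonomials ℕ+ Coef).constr Coef fun m' =>
      (m.prod fun k a => ((k : ℕ) : Coef) ^ a * ((m' k).descFactorial a : Coef)) • pMon (m' - m)


theorem basisMonomials_eq (m : ℕ+ →₀ ℕ) :
    MvPolynomial.basisMonomials ℕ+ Coef m = pMon m := by
  simp [pMon]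

theorem scalar_pMon (w : ℕ+ → Coef) (m m' : ℕ+ →₀ ℕ) :
    scalar w (pMon m) (pMon m') =
      if m = m' then m.prod fun k a => ((k : ℕ) : Coef) ^ a * (a ! : Coef) * w k ^ a else 0 := by
  rw [← basisMonomials_eq, ← basisMonomials_eq, scalar, Module.Basis.constr_basis,
    Module.Basis.constr_basis]

theorem perp_pMon (m m' : ℕ+ →₀ ℕ) :
    perp (pMon m) (pMon m') =
      (m.prod fun k a => ((k : ℕ) : Coef) ^ a * ((m' k).descFactorial a : Coef)) •
        pMon (m' - m) := by
  rw [← basisMonomials_eq m, ← basisMonomials_eq m', perp, Module.Basis.constr_basis,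
    Module.Basis.constr_basis]

theorem perp_pMon_eq_zero {m m' : ℕ+ →₀ ℕ} (hm : ¬ m ≤ m') : perp (pMon m) (pMon m') = 0 := by
  rw [perp_pMon]
  obtain ⟨k, hk⟩ : ∃ k, m' k < m k := by
    by_contra hcon
    push Not at hcon
    exact hm hcon
  have hz : (m.prod fun k a => ((k : ℕ) : Coef) ^ a * ((m' k).descFactorial a : Coef)) = 0 := by
    refine Finset.prod_eq_zero (i := k) (Finsupp.mem_support_iff.2 (by omega)) ?_
    simp [Nat.descFactorial_eq_zero_iff_lt.2 hk]
  rw [hz, zero_smul]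

theorem pMon_mul (m m' : ℕ+ →₀ ℕ) : pMon m * pMon m' = pMon (m + m') := by
  simp [pMon, MvPolynomial.monomial_mul]

theorem monomial_eq_smul_pMon (m : ℕ+ →₀ ℕ) (a : Coef) :
    MvPolynomial.monomial m a = a • pMon m := by
  simp [pMon, MvPolynomial.smul_monomial]

theorem hall_perp_pMon (m n r : ℕ+ →₀ ℕ) :
    hall (perp (pMon m) (pMon n)) (pMon r) = hall (pMon n) (pMon m * pMon r) := by
  rw [pMon_mul, hall, scalar_pMon]
  by_cases hm : m ≤ n
  · rw [perp_pMon, map_smul, LinearMap.smul_apply, scalar_pMon]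
    by_cases hr : n = m + r
    · subst hr
      simp only [add_tsub_cancel_left, if_true, smul_eq_mul, one_pow, mul_one]
      rw [Finsupp.prod_of_support_subset m (s := (m + r).support) (by
          intro k hk; simp at hk ⊢; omega) _ (by simp),
        Finsupp.prod_of_support_subset r (s := (m + r).support) (by
          intro k hk; simp at hk ⊢; omega) _ (by simp), Finsupp.prod, ← Finset.prod_mul_distrib]
      refine Finset.prod_congr rfl fun k _ => ?_
      have hf := Nat.factorial_mul_descFactorial (Nat.le_add_right (m k) (r k))
      rw [Nat.add_sub_cancel_left] at hf
      rw [Finsupp.add_apply, ← hf, pow_add]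
      push_cast
      ring
    · have hr' : ¬ n - m = r := fun e => hr (by rw [← e, add_tsub_cancel_of_le hm])
      simp [hr, hr']
  · rw [perp_pMon_eq_zero hm, if_neg]
    · simp
    · rintro rfl
      exact hm le_self_add

/-- `f^⊥` is adjoint to multiplication by `f` for the Hall scalar product. -/
theorem hall_perp (f g u : Sym) : hall (perp f g) u = hall g (f * u) := by
  induction f using MvPolynomial.induction_on' with
  | add f₁ f₂ h₁ h₂ => simp only [map_add, LinearMap.add_apply, add_mul, h₁, h₂]
  | monomial m a =>
    induction g using MvPolynomial.induction_on' with
    | add f₁ f₂ h₁ h₂ => simp only [map_add, LinearMap.add_apply, h₁, h₂]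
    | monomial n b =>
      induction u using MvPolynomial.induction_on' with
      | add f₁ f₂ h₁ h₂ => simp only [map_add, mul_add, h₁, h₂]
      | monomial r c =>
        simp only [monomial_eq_smul_pMon, map_smul, LinearMap.smul_apply, smul_mul_assoc,
          mul_smul_comm, hall_perp_pMon]
        simp only [smul_eq_mul]
        ring

/-- `h_r[X·c]` is homogeneous of degree `r`, where `p_k` has degree `k`. -/
theorem isWeightedHomogeneous_pleth_hNat (c : ℕ+ → Coef) (r : ℕ) :
    MvPolynomial.IsWeightedHomogeneous (fun k : ℕ+ => (k : ℕ)) (pleth c (hNat r)) r := by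
  induction r using Nat.strong_induction_on with
  | _ r ih =>
    cases r with
    | zero =>
      rw [hNat, map_one]
      exact MvPolynomial.isWeightedHomogeneous_one _ _
    | succ r =>
      rw [hNat, map_mul, map_sum]
      have e0 : r + 1 = 0 + (r + 1) := by omega
      conv => arg 3; rw [e0]
      refine MvPolynomial.IsWeightedHomogeneous.mul ?_ ?_
      · rw [pleth, MvPolynomial.algHom_C]
        exact MvPolynomial.isWeightedHomogeneous_C _ _
      · refine MvPolynomial.IsWeightedHomogeneous.sum _ _ _ fun i _ => ?_
        rw [map_mul]
        have e : r + 1 = (0 + ((Nat.succPNat i : ℕ+) : ℕ)) + (r - i) := by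
          simp only [Nat.succPNat_coe]; omega
        conv => arg 3; rw [e]
        refine MvPolynomial.IsWeightedHomogeneous.mul ?_ (ih _ (by omega))
        rw [p, pleth, MvPolynomial.aeval_X]
        exact (MvPolynomial.isWeightedHomogeneous_C _ _).mul
          (MvPolynomial.isWeightedHomogeneous_X _ _ _)

/-- `f^⊥` lowers degrees by the degree of `f`. -/
theorem perp_eq_zero_of_lt {r : ℕ} {f g : Sym}
    (hf : MvPolynomial.IsWeightedHomogeneous (fun k : ℕ+ => (k : ℕ)) f r)
    (hg : MvPolynomial.weightedTotalDegree (fun k : ℕ+ => (k : ℕ)) g < r) : perp f g = 0 := by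
  rw [f.as_sum, g.as_sum, map_sum]
  refine Finset.sum_eq_zero fun n hn => ?_
  rw [map_sum, LinearMap.sum_apply]
  refine Finset.sum_eq_zero fun m hm => ?_
  have hnm : ¬ m ≤ n := by
    intro hle
    have h1 := hf (MvPolynomial.mem_support_iff.1 hm)
    have h2 := MvPolynomial.le_weightedTotalDegree (fun k : ℕ+ => (k : ℕ)) hn
    obtain ⟨d, rfl⟩ := exists_add_of_le hle
    rw [map_add] at h2
    omega
  simp only [monomial_eq_smul_pMon, map_smul, LinearMap.smul_apply, perp_pMon_eq_zero hnm,
    smul_zero]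

/-- On a given `f` only finitely many terms of the sum defining `vertexOp` are nonzero. -/
theorem vertexOp_finite (l : ℤ) (f : Sym) :
    (Function.support fun i : ℕ => h ((i : ℤ) + l) * perp (plethMul (h i)) f).Finite := by
  refine (Set.finite_Iic
    (MvPolynomial.weightedTotalDegree (fun k : ℕ+ => (k : ℕ)) f)).subset fun i hi => ?_
  by_contra hlt
  refine hi ?_
  have hz : perp (plethMul (h i)) f = 0 := by
    refine perp_eq_zero_of_lt (r := i) ?_ (by simpa using hlt)
    simpa [h, plethMul] using isWeightedHomogeneous_pleth_hNat (fun k => t ^ (k : ℕ) - 1) i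
  simp only [hz, mul_zero]

theorem coeff_hsymm (σ : Type*) [Fintype σ] [DecidableEq σ] (r : ℕ) (d : σ →₀ ℕ) :
    MvPolynomial.coeff d (MvPolynomial.hsymm σ Coef r) = if d.degree = r then 1 else 0 := by
  have hmon : ∀ s : Multiset σ, (s.map (MvPolynomial.X (R := Coef))).prod =
      MvPolynomial.monomial (Multiset.toFinsupp s) 1 := by
    intro s
    induction s using Multiset.induction_on with
    | empty => simp
    | cons a s ih =>
      rw [Multiset.map_cons, Multiset.prod_cons, ih, ← Multiset.singleton_add, map_add,
        Multiset.toFinsupp_singleton, MvPolynomial.X, MvPolynomial.monomial_mul, one_mul]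
  have hdeg : ∀ s : Multiset σ, (Multiset.toFinsupp s).degree = Multiset.card s := by
    intro s
    induction s using Multiset.induction_on with
    | empty => simp
    | cons a s ih =>
      rw [← Multiset.singleton_add, map_add, map_add, ih, Multiset.toFinsupp_singleton]
      simp [add_comm]
  rw [MvPolynomial.hsymm, MvPolynomial.coeff_sum]
  simp only [hmon, MvPolynomial.coeff_monomial]
  split_ifs with hd
  · have hc : Multiset.card (Finsupp.toMultiset d) = r := by
      rw [← hdeg, Finsupp.toMultiset_toFinsupp, hd]
    refine (Finset.sum_eq_single (⟨Finsupp.toMultiset d, hc⟩ : _root_.Sym σ r) ?_ ?_).trans ?_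
    rotate_left 2
    · rw [if_pos (Finsupp.toMultiset_toFinsupp d)]
    · intro s _ hs
      rw [if_neg]
      intro e
      apply hs
      apply Subtype.ext
      change s.1 = Finsupp.toMultiset d
      rw [← e, Multiset.toFinsupp_toMultiset]
    · exact fun hn => absurd (Finset.mem_univ (α := _root_.Sym σ r) _) hn
  · refine Finset.sum_eq_zero fun s _ => if_neg ?_
    rintro rfl
    exact hd ((hdeg _).trans s.2)

theorem sum_psum_mul_hsymm (σ : Type*) [Fintype σ] [DecidableEq σ] (r : ℕ) :
    ∑ i : Fin (r + 1),
      MvPolynomial.psum σ Coef ((i : ℕ) + 1) * MvPolynomial.hsymm σ Coef (r - i) =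
      MvPolynomial.C ((r : Coef) + 1) * MvPolynomial.hsymm σ Coef (r + 1) := by
  ext d
  rw [MvPolynomial.coeff_sum, MvPolynomial.coeff_C_mul, coeff_hsymm]
  have hterm : ∀ i : Fin (r + 1), MvPolynomial.coeff d
      (MvPolynomial.psum σ Coef ((i : ℕ) + 1) * MvPolynomial.hsymm σ Coef (r - i)) =
      if d.degree = r + 1 then ∑ j : σ, (if (i : ℕ) < d j then (1 : Coef) else 0) else 0 := by
    intro i
    rw [MvPolynomial.psum, Finset.sum_mul, MvPolynomial.coeff_sum]
    have hj : ∀ j : σ, MvPolynomial.coeff d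
        (MvPolynomial.X j ^ ((i : ℕ) + 1) * MvPolynomial.hsymm σ Coef (r - i)) =
        if d.degree = r + 1 then (if (i : ℕ) < d j then (1 : Coef) else 0) else 0 := by
      intro j
      rw [MvPolynomial.X_pow_eq_monomial, MvPolynomial.coeff_monomial_mul', one_mul,
        coeff_hsymm]
      have hi := i.2
      by_cases hlt : (i : ℕ) < d j
      · have hle : Finsupp.single j ((i : ℕ) + 1) ≤ d := Finsupp.single_le_iff.2 hlt
        have hdd : (d - Finsupp.single j ((i : ℕ) + 1)).degree + (i + 1) = d.degree := by
          conv_rhs => rw [← tsub_add_cancel_of_le hle, map_add, Finsupp.degree_single]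
        rw [if_pos hle, if_pos hlt]
        congr 1
        apply propext
        omega
      · rw [if_neg (fun hle => hlt (Finsupp.single_le_iff.1 hle)), if_neg hlt, ite_self]
    simp only [hj]
    split_ifs <;> simp
  simp only [hterm]
  split_ifs with hd
  · rw [Finset.sum_comm, mul_one]
    have hcol : ∀ j : σ, ∑ i : Fin (r + 1), (if (i : ℕ) < d j then (1 : Coef) else 0) = d j := by
      intro j
      have hle : d j ≤ r + 1 := hd ▸ Finsupp.le_degree j d
      rw [Fin.sum_univ_eq_sum_range (fun i => if i < d j then (1 : Coef) else 0) (r + 1),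
        Finset.sum_ite, Finset.sum_const_zero, add_zero, Finset.sum_const, nsmul_one]
      congr 1
      refine Eq.trans ?_ (Finset.card_range (d j))
      congr 1
      ext x
      simp only [Finset.mem_filter, Finset.mem_range]
      omega
    simp only [hcol]
    rw [← Nat.cast_sum, ← Finsupp.degree_eq_sum, hd]
    push_cast
    rfl
  · simp

/-- In finitely many variables, `h_r` is the sum of all monomials of degree `r`. -/
theorem inVars_hNat (σ : Type*) [Fintype σ] [DecidableEq σ] (r : ℕ) :
    inVars σ (hNat r) = MvPolynomial.hsymm σ Coef r := by
  induction r using Nat.strong_induction_on with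
  | _ r ih =>
    cases r with
    | zero => simp [hNat]
    | succ r =>
      have e : inVars σ (hNat (r + 1)) = MvPolynomial.C (1 / ((r : Coef) + 1)) *
          ∑ i : Fin (r + 1),
            MvPolynomial.psum σ Coef ((i : ℕ) + 1) * MvPolynomial.hsymm σ Coef (r - i) := by
        rw [hNat, map_mul, map_sum]
        congr 1
        · rw [inVars, MvPolynomial.algHom_C]; rfl
        · refine Finset.sum_congr rfl fun i _ => ?_
          rw [map_mul, ih _ (by omega), p, inVars, MvPolynomial.aeval_X, Nat.succPNat_coe]
      rw [e, sum_psum_mul_hsymm, ← mul_assoc, ← MvPolynomial.C_mul, one_div_mul_cancel,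
        MvPolynomial.C_1, one_mul]
      exact_mod_cast Nat.succ_ne_zero r

/-! ### Vertex operators and generalized Schur products -/

/-- The vertex operator `B_ℓ = ∑_{i ≥ 0} s_{i+ℓ}[X] s_i[X(t-1)]^⊥`, `ℓ ∈ ℤ`, where `s_r = h_r`.
Only finitely many terms of the sum are nonzero on a given `f` (`vertexOp_finite`). -/
def vertexOp (l : ℤ) (f : Sym) : Sym := ∑ᶠ i : ℕ, h ((i : ℤ) + l) * perp (plethMul (h i)) f

/-- `B_{a_1} ∘ ⋯ ∘ B_{a_m}`. -/
def vertexOps (a : List ℤ) (f : Sym) : Sym := a.foldr vertexOp f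

/-- `B_λ = ∏_{i<j} (1 - t e_{ij}) B_{λ_1} ⋯ B_{λ_m}`, `m` the length of `λ`, where `e_{ij}` raises
the `i`-th index by one and lowers the `j`-th index by one. The product over the pairs `i < j` is
expanded: the set `A` holds the pairs that contribute `-t e_{ij}`. -/
def partOp (l : List ℕ) (f : Sym) : Sym :=
  ∑ A ∈ (Finset.univ.filter fun x : Fin l.length × Fin l.length => x.1 < x.2).powerset,
    (-t) ^ A.card • vertexOps
      (List.ofFn fun i : Fin l.length =>
        (l.get i : ℤ) + ((A.filter fun x => x.1 = i).card : ℤ)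
          - ((A.filter fun x => x.2 = i).card : ℤ)) f

/-- The generalized Schur product `𝓗_S`: `𝓗_() = 1` and
`𝓗_(λ⁽¹⁾, λ⁽²⁾, …) = B_{λ⁽¹⁾} 𝓗_(λ⁽²⁾, …)`. -/
def genSchur : List (List ℕ) → Sym
  | [] => 1
  | l :: S => partOp l (genSchur S)

/-! ### Hall–Littlewood polynomials -/

/-- The Hall–Littlewood function `P_λ[X;t]`: the family with `P_λ ∈ s_λ + span {s_μ : μ < λ}` that
is orthogonal for `⟨ , ⟩_t`, obtained by orthogonalizing the Schur functions along dominance order: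
`P_λ = s_λ - ∑_{μ<λ} (⟨s_λ, P_μ⟩_t / ⟨P_μ, P_μ⟩_t) P_μ`. -/
def hallLittlewoodP {n : ℕ} : n.Partition → Sym :=
  domLT_wf.fix fun lam P =>
    schur lam - ∑ mu : {mu // mu ∈ below lam},
      (scalarT (schur lam) (P mu.1 (by simpa [below] using mu.2)) /
        scalarT (P mu.1 (by simpa [below] using mu.2)) (P mu.1 (by simpa [below] using mu.2))) •
          P mu.1 (by simpa [below] using mu.2)

/-- The defining recursion of `hallLittlewoodP`. -/
theorem hallLittlewoodP_eq {n : ℕ} (lam : n.Partition) :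
    hallLittlewoodP lam = schur lam - ∑ mu ∈ below lam,
      (scalarT (schur lam) (hallLittlewoodP mu) /
        scalarT (hallLittlewoodP mu) (hallLittlewoodP mu)) • hallLittlewoodP mu := by
  rw [hallLittlewoodP, WellFounded.fix_eq]
  congr 1
  exact Finset.sum_coe_sort (below lam) fun mu =>
    (scalarT (schur lam) (hallLittlewoodP mu) /
        scalarT (hallLittlewoodP mu) (hallLittlewoodP mu)) • hallLittlewoodP mu

/-- `b_λ(t) = ∏_k (1-t)(1-t²)⋯(1-t^{m_k})`, with `m_k` the number of parts of `λ` equal to `k`; this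
is `∏ (1 - t^{ℓ(s)+1})` over the cells `s` of `λ` with arm length `0`, `ℓ(s)` the leg length. -/
def bCoef {n : ℕ} (lam : n.Partition) : Coef :=
  ∏ k ∈ lam.parts.toFinset, ∏ j ∈ Finset.range (lam.parts.count k), (1 - t ^ (j + 1))

/-- The Hall–Littlewood function `Q_λ[X;t] = b_λ(t) P_λ[X;t]`. -/
def hallLittlewoodQ {n : ℕ} (lam : n.Partition) : Sym := bCoef lam • hallLittlewoodP lam

/-- The (modified) Hall–Littlewood polynomial `H_λ[X;t] = Q_λ[X/(1-t);t]`. -/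
def hallLittlewoodH {n : ℕ} (lam : n.Partition) : Sym := plethDiv (hallLittlewoodQ lam)

end GenSchur

end

noncomputable section

namespace GenSchur

/-! ### The Hall scalar product and the operators `f^⊥` -/

/-! Every operator in sight has the form f ↦ Σ_i h_{i+r} (h_i[cX])^⊥ f for an alphabet c. Here
(h_i[cX])^⊥ f is the coefficient of y^i in f[X + cy] (`skew_eq_perp`), so a sum of alphabets becomes
a composition of translations (`bern_add`). The family `vertex s r`, with c = s - 1, contains both
B_r (s = t) and Bernstein's operator (s = 0). Words in the latter are the Jacobi–Trudi determinants
(`vertexWord_ofFn`).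

Schur expansion. Since t - 1 = (0 - 1) + t, B_r is the sum over k of Bernstein's operator of index r
+ k after skewing by the coefficient of y^k in f[X + ty]. This skewing lowers the entries of a
Bernstein word by k in total, with coefficients in ℤ[t], while the new first entry gains k. Hence
B_r sends the word of a to the word of (r, a) plus a ℤ[t]-combination of strictly dominating words
(`vertex_t_vertexWord`). Raising operators also move upwards (`seqDom_raise`), so the generalized
Schur product is the word of λ plus strictly higher words (`genSchur_sub_mem`). Straightening turns
each word into 0 or ± a Schur function whose partition dominates the word
(`vertexWord_zero_straighten`).

Hall–Littlewood expansion. The point is Jing's formula H_μ = B_{μ_1} ⋯ B_{μ_m} · 1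
(`hallLittlewoodH_eq_jing`). The commutation rule `skew_vertex` shows that the partition words for
parameter s are orthogonal for ⟨f[X(1-s)], g⟩. The case s = 0 is orthonormality of the Schur
functions; for s = t the norm is b_μ. The Jing word is the generalized Schur product of the one-row
partitions (μ_1), (μ_2), …, so it is unitriangular in the Schur basis by the first half. By duality
s_λ involves only the dual functions with μ ≤ λ, and orthogonalization then yields P_λ. Inverting
the unitriangular matrix over ℤ[t] (`span_above_le`) turns the Schur expansion into the
Hall–Littlewood one. Uniqueness is linear independence, which follows from the orthogonality
relations. -/

theorem sym_ext_pMon {V : Type*} [AddCommMonoid V] [Module Coef V] {F G : Sym →ₗ[Coef] V}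
    (hFG : ∀ m, F (pMon m) = G (pMon m)) : F = G :=
  (MvPolynomial.basisMonomials ℕ+ Coef).ext fun m => by
    rw [basisMonomials_eq, hFG]

theorem scalar_comm (w : ℕ+ → Coef) (f g : Sym) : scalar w f g = scalar w g f := by
  have : scalar w = (scalar w).flip := by
    refine sym_ext_pMon fun m => sym_ext_pMon fun m' => ?_
    rw [LinearMap.flip_apply, scalar_pMon, scalar_pMon]
    by_cases hm : m = m'
    · subst hm; rfl
    · rw [if_neg hm, if_neg (Ne.symm hm)]
  exact congrArg (fun F => F f g) this

theorem pleth_pMon (c : ℕ+ → Coef) (m : ℕ+ →₀ ℕ) :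
    pleth c (pMon m) = (m.prod fun k a => c k ^ a) • pMon m := by
  rw [pleth, pMon, MvPolynomial.aeval_monomial, map_one, one_mul]
  simp only [mul_pow, Finsupp.prod_mul]
  rw [MvPolynomial.monomial_eq, MvPolynomial.C_1, one_mul, MvPolynomial.smul_eq_C_mul]
  congr 1
  simp [Finsupp.prod, map_prod]

/-- Rescaling each p_k by c_k changes only the weight in the diagonal form. This makes plethysms
self-adjoint and relates ⟨ , ⟩_t to the Hall product. -/
theorem hall_pleth (c : ℕ+ → Coef) (f g : Sym) : hall (pleth c f) g = scalar c f g := by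
  have : hall ∘ₗ (pleth c).toLinearMap = scalar c := by
    refine sym_ext_pMon fun m => sym_ext_pMon fun m' => ?_
    rw [LinearMap.comp_apply, AlgHom.toLinearMap_apply, pleth_pMon, map_smul,
      LinearMap.smul_apply, hall, scalar_pMon, scalar_pMon]
    split_ifs
    · simp only [Finsupp.prod, smul_eq_mul, one_pow, mul_one]
      rw [← Finset.prod_mul_distrib]
      exact Finset.prod_congr rfl fun _ _ => mul_comm _ _
    · simp
  exact congrArg (fun F => F f g) this

theorem hall_comm (f g : Sym) : hall f g = hall g f := scalar_comm _ f g

theorem hall_pleth_right (c : ℕ+ → Coef) (f g : Sym) :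
    hall f (pleth c g) = hall (pleth c f) g := by
  rw [hall_comm, hall_pleth, hall_pleth, scalar_comm]

/-- The power-sum monomials are orthogonal with norms z_λ ≠ 0, so pairing with one of them isolates
a coefficient of f. -/
theorem hall_nondegenerate {f : Sym} (hf : ∀ g, hall f g = 0) : f = 0 := by
  ext m
  rw [MvPolynomial.coeff_zero]
  have h1 := hf (pMon m)
  rw [f.as_sum, map_sum, LinearMap.sum_apply] at h1
  simp only [monomial_eq_smul_pMon, map_smul, LinearMap.smul_apply, hall, scalar_pMon] at h1
  by_contra hm
  rw [Finset.sum_eq_single m (fun b _ hb => by simp [hb])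
    (fun hb => absurd (MvPolynomial.mem_support_iff.2 hm) hb)] at h1
  rw [if_pos rfl, smul_eq_mul, mul_eq_zero] at h1
  refine h1.elim hm fun h2 => ?_
  rw [Finsupp.prod, Finset.prod_eq_zero_iff] at h2
  obtain ⟨k, -, hk⟩ := h2
  simp [Nat.factorial_ne_zero] at hk

theorem perp_mul (f g u : Sym) : perp (f * g) u = perp f (perp g u) := by
  rw [← sub_eq_zero]
  refine hall_nondegenerate fun v => ?_
  rw [map_sub, LinearMap.sub_apply, hall_perp, hall_perp, hall_perp, sub_eq_zero, mul_comm f,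
    mul_assoc]

theorem perp_one (u : Sym) : perp 1 u = u := by
  rw [← sub_eq_zero]
  refine hall_nondegenerate fun v => ?_
  rw [map_sub, LinearMap.sub_apply, hall_perp, one_mul, sub_self]

theorem perp_comm (f g u : Sym) : perp f (perp g u) = perp g (perp f u) := by
  rw [← perp_mul, mul_comm, perp_mul]

/-- `p_k^⊥ = k ∂/∂p_k`. -/
theorem perp_p (k : ℕ+) (f : Sym) :
    perp (p k) f = ((k : ℕ) : Coef) • MvPolynomial.pderiv k f := by
  have : perp (p k) = ((k : ℕ) : Coef) • (MvPolynomial.pderiv (R := Coef) k).toLinearMap := by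
    refine sym_ext_pMon fun m => ?_
    rw [show p k = pMon (Finsupp.single k 1) from rfl, perp_pMon,
      Finsupp.prod_single_index (by simp), LinearMap.smul_apply,
      Derivation.coeFn_coe, pMon, pMon, MvPolynomial.pderiv_monomial]
    simp [MvPolynomial.smul_monomial]
  rw [this]; rfl

theorem perp_p_mul (k : ℕ+) (f g : Sym) :
    perp (p k) (f * g) = perp (p k) f * g + f * perp (p k) g := by
  simp only [perp_p, Derivation.leibniz, smul_add, smul_eq_mul, mul_smul_comm, smul_mul_assoc]
  rw [mul_comm g, add_comm]

theorem perp_p_p (k n : ℕ+) : perp (p k) (p n) = if k = n then ((k : ℕ) : Sym) else 0 := by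
  rw [perp_p, p, MvPolynomial.pderiv_X]
  split_ifs with hk
  · subst hk
    simp [MvPolynomial.smul_eq_C_mul]
  · simp [Ne.symm hk]

theorem perp_p_C (k : ℕ+) (a : Coef) : perp (p k) (MvPolynomial.C a) = 0 := by
  rw [perp_p, MvPolynomial.pderiv_C, smul_zero]

/-! ### Translations `f ↦ f[X + c y]` -/

/-- The translation `f ↦ f[X + c y]`, given by `p_k ↦ p_k + c_k y^k`. -/
def shiftHom (c : ℕ+ → Coef) : Sym →ₐ[Coef] Sym[X] :=
  MvPolynomial.aeval fun k =>
    Polynomial.C (p k) + Polynomial.C (MvPolynomial.C (c k)) * Polynomial.X ^ (k : ℕ)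

/-- The coefficient of `y^k` in `f[X + c y]`; see `skew_eq_perp`. -/
def skew (c : ℕ+ → Coef) (k : ℕ) : Sym →ₗ[Coef] Sym :=
  (Polynomial.lcoeff Sym k).restrictScalars Coef ∘ₗ (shiftHom c).toLinearMap

theorem skew_apply (c : ℕ+ → Coef) (k : ℕ) (f : Sym) : skew c k f = (shiftHom c f).coeff k := rfl

theorem shiftHom_p (c : ℕ+ → Coef) (k : ℕ+) : shiftHom c (p k) =
    Polynomial.C (p k) + Polynomial.C (MvPolynomial.C (c k)) * Polynomial.X ^ (k : ℕ) :=
  MvPolynomial.aeval_X _ _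

theorem shiftHom_C (c : ℕ+ → Coef) (a : Coef) :
    shiftHom c (MvPolynomial.C a) = Polynomial.C (MvPolynomial.C a) := by
  rw [shiftHom, MvPolynomial.algHom_C]; rfl

/-- The defect of the Euler identity for `shiftHom`, truncated at degree `N`. -/
theorem X_pow_dvd_euler (c : ℕ+ → Coef) (N : ℕ) (f : Sym) :
    (Polynomial.X : Sym[X]) ^ (N + 1) ∣
      Polynomial.X * Polynomial.derivative (shiftHom c f) - ∑ i ∈ Finset.range N,
        Polynomial.C (MvPolynomial.C (c (Nat.succPNat i))) * Polynomial.X ^ (i + 1) *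
          shiftHom c (perp (p (Nat.succPNat i)) f) := by
  induction f using MvPolynomial.induction_on with
  | C a => simp [perp_p_C]
  | add f g hf hg =>
    convert dvd_add hf hg using 1
    simp only [map_add, mul_add, Finset.sum_add_distrib]
    ring
  | mul_X f n hf =>
    have hX : (MvPolynomial.X n : Sym) = p n := rfl
    have hn : (Polynomial.X : Sym[X]) ^ (N + 1) ∣
        Polynomial.X * Polynomial.derivative (shiftHom c (p n)) - ∑ i ∈ Finset.range N,
        Polynomial.C (MvPolynomial.C (c (Nat.succPNat i))) * Polynomial.X ^ (i + 1) *
          shiftHom c (perp (p (Nat.succPNat i)) (p n)) := by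
      obtain ⟨m, rfl⟩ : ∃ m, n = Nat.succPNat m := ⟨n.natPred, (PNat.succPNat_natPred n).symm⟩
      have h1 : Polynomial.X * Polynomial.derivative (shiftHom c (p (Nat.succPNat m))) =
          Polynomial.C (MvPolynomial.C (c (Nat.succPNat m))) * Polynomial.X ^ (m + 1) *
            ((m + 1 : ℕ) : Sym[X]) := by
        simp only [shiftHom_p, map_add, Polynomial.derivative_C, zero_add,
          Polynomial.derivative_C_mul_X_pow, Nat.succPNat_coe, Nat.succ_eq_add_one,
          Nat.add_sub_cancel, map_mul, map_natCast]
        ring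
      rw [h1]
      by_cases hm : m < N
      · rw [Finset.sum_eq_single_of_mem m (Finset.mem_range.2 hm)]
        · simp [perp_p_p]
        · intro b _ hb
          rw [perp_p_p, if_neg (fun e => hb (Nat.succPNat_injective e)), map_zero, mul_zero]
      · rw [Finset.sum_eq_zero, sub_zero]
        · exact ((pow_dvd_pow _ (by omega)).mul_left _).mul_right _
        · intro b hb
          have := Finset.mem_range.1 hb
          rw [perp_p_p, if_neg (fun e => by have := Nat.succPNat_injective e; omega), map_zero,
            mul_zero]
    -- Both terms of the defect obey the Leibniz rule along `shiftHom c`, so the defect of a product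
    -- is a combination of the defects of its factors.
    convert dvd_add (hf.mul_right (shiftHom c (p n))) (hn.mul_left (shiftHom c f)) using 1
    rw [hX]
    simp only [perp_p_mul, map_mul, map_add, Polynomial.derivative_mul, mul_add,
      Finset.sum_add_distrib, sub_mul, mul_sub, Finset.sum_mul, Finset.mul_sum]
    have e1 : ∀ a b d : Sym[X], a * (b * d) = a * b * d := fun a b d => (mul_assoc _ _ _).symm
    have e2 : ∀ i, shiftHom c f * (Polynomial.C (MvPolynomial.C (c (Nat.succPNat i))) *
        Polynomial.X ^ (i + 1) * shiftHom c (perp (p (Nat.succPNat i)) (p n))) =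
        Polynomial.C (MvPolynomial.C (c (Nat.succPNat i))) *
        Polynomial.X ^ (i + 1) * shiftHom c f * shiftHom c (perp (p (Nat.succPNat i)) (p n)) :=
      fun i => by ring
    simp only [e2, e1]
    ring

theorem skew_zero (c : ℕ+ → Coef) (f : Sym) : skew c 0 f = f := by
  have : (Polynomial.constantCoeff.comp (shiftHom c).toRingHom) = RingHom.id Sym := by
    refine MvPolynomial.ringHom_ext (fun a => ?_) fun k => ?_
    · simp
    · have := shiftHom_p c k
      rw [p] at this
      simp [this, k.ne_zero.symm]
  exact congrArg (fun F => F f) this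

/-- The coefficient of y^(r+1) in the Euler identity y d/dy f[X + cy] = Σ_k c_k y^k (p_k^⊥ f)[X +
cy]. -/
theorem skew_succ (c : ℕ+ → Coef) (r : ℕ) (f : Sym) :
    ((r : Coef) + 1) • skew c (r + 1) f =
      ∑ i : Fin (r + 1), c (Nat.succPNat i) • skew c (r - i) (perp (p (Nat.succPNat i)) f) := by
  have h1 := X_pow_dvd_euler c (r + 1) f
  rw [Polynomial.X_pow_dvd_iff] at h1
  have h2 := h1 (r + 1) (by omega)
  rw [Polynomial.coeff_sub, sub_eq_zero, Polynomial.coeff_X_mul, Polynomial.coeff_derivative,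
    Polynomial.finsetSum_coeff] at h2
  rw [Fin.sum_univ_eq_sum_range
    (fun i => c (Nat.succPNat i) • skew c (r - i) (perp (p (Nat.succPNat i)) f))]
  have h3 : ((r : Coef) + 1) • skew c (r + 1) f = (shiftHom c f).coeff (r + 1) * (r + 1) := by
    rw [skew_apply, MvPolynomial.smul_eq_C_mul, mul_comm]
    simp
  rw [h3, h2]
  refine Finset.sum_congr rfl fun i hi => ?_
  have := Finset.mem_range.1 hi
  rw [mul_assoc, Polynomial.coeff_C_mul, Polynomial.coeff_X_pow_mul', if_pos (by omega),
    MvPolynomial.smul_eq_C_mul, Nat.add_sub_add_right]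
  rfl

theorem natCast_add_one_ne_zero (r : ℕ) : (r : Coef) + 1 ≠ 0 := by
  exact_mod_cast Nat.succ_ne_zero r

/-- Newton's recursion for h_r[cX], transported through ⊥, is the recursion `skew_succ`; both sides
agree at r = 0. -/
theorem skew_eq_perp (c : ℕ+ → Coef) (r : ℕ) (f : Sym) :
    skew c r f = perp (pleth c (hNat r)) f := by
  induction r using Nat.strong_induction_on generalizing f with
  | _ r ih =>
    cases r with
    | zero => rw [hNat, map_one, perp_one, skew_zero]
    | succ r =>
      have hr := natCast_add_one_ne_zero r
      rw [← (smul_right_injective Sym hr).eq_iff]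
      rw [skew_succ, hNat, map_mul, ← MvPolynomial.algebraMap_eq, AlgHom.commutes,
        ← Algebra.smul_def, map_smul, LinearMap.smul_apply, smul_smul, mul_one_div_cancel hr,
        one_smul, map_sum, map_sum, LinearMap.sum_apply]
      refine Finset.sum_congr rfl fun i _ => ?_
      rw [ih _ (by omega), map_mul, mul_comm, perp_mul,
        show pleth c (p (Nat.succPNat i)) = c (Nat.succPNat i) • p (Nat.succPNat i) by
          rw [pleth, p, MvPolynomial.aeval_X, MvPolynomial.smul_eq_C_mul]; rfl,
        map_smul, LinearMap.smul_apply, map_smul]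

theorem skew_mul (c : ℕ+ → Coef) (n : ℕ) (f g : Sym) :
    skew c n (f * g) = ∑ x ∈ Finset.HasAntidiagonal.antidiagonal n, skew c x.1 f * skew c x.2 g := by
  rw [skew_apply, map_mul, Polynomial.coeff_mul]; rfl

theorem skew_comm (c c' : ℕ+ → Coef) (i j : ℕ) (f : Sym) :
    skew c i (skew c' j f) = skew c' j (skew c i f) := by
  simp only [skew_eq_perp]
  exact perp_comm _ _ _

/-! ### Skewing the complete symmetric functions -/

theorem h_natCast (n : ℕ) : h n = hNat n := by simp [h]

theorem h_of_neg {n : ℤ} (hn : n < 0) : h n = 0 := by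
  rw [h, if_neg (by omega)]

theorem h_zero : h 0 = 1 := by
  rw [show (0 : ℤ) = ((0 : ℕ) : ℤ) from rfl, h_natCast, hNat]

theorem hNat_succ (r : ℕ) : ((r : Coef) + 1) • hNat (r + 1) =
    ∑ i ∈ Finset.range (r + 1), p (Nat.succPNat i) * h ((r : ℤ) - i) := by
  rw [hNat, ← MvPolynomial.smul_eq_C_mul, smul_smul,
    mul_one_div_cancel (natCast_add_one_ne_zero r), one_smul,
    Fin.sum_univ_eq_sum_range (fun i => p (Nat.succPNat i) * hNat (r - i))]
  refine Finset.sum_congr rfl fun i hi => ?_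
  have := Finset.mem_range.1 hi
  rw [← h_natCast, Nat.cast_sub (by omega)]

/-- `p_k^⊥ h_n = h_{n-k}`. -/
theorem perp_p_h (m : ℕ) (n : ℤ) : perp (p (Nat.succPNat m)) (h n) = h (n - (m + 1)) := by
  rcases lt_or_ge n 0 with hn | hn
  · rw [h_of_neg hn, h_of_neg (by omega), map_zero]
  lift n to ℕ using hn
  induction n using Nat.strong_induction_on with
  | _ n ih =>
    cases n with
    | zero =>
      rw [Nat.cast_zero, h_zero, h_of_neg (by omega), ← MvPolynomial.C_1, perp_p_C]
    | succ r =>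
      have hr := natCast_add_one_ne_zero r
      rw [← (smul_right_injective Sym hr).eq_iff]
      rw [h_natCast, ← map_smul, hNat_succ, map_sum]
      -- p_{m+1}^⊥ is a derivation. Applied to Newton's recursion for h_{r+1}, it hits either the
      -- factor p_{m+1} or, by induction, the factor h_{r-i}.
      have e : ∀ i ∈ Finset.range (r + 1),
          perp (p (Nat.succPNat m)) (p (Nat.succPNat i) * h ((r : ℤ) - i)) =
          (if m = i then ((m + 1 : ℕ) : Sym) * h ((r : ℤ) - m) else 0) +
            p (Nat.succPNat i) * h ((r : ℤ) - (m + 1) - i) := by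
        intro i hi
        have := Finset.mem_range.1 hi
        have e1 := ih (r - i) (by omega)
        rw [Nat.cast_sub (by omega)] at e1
        rw [perp_p_mul, e1, perp_p_p]
        congr 1
        · by_cases hmi : m = i
          · subst hmi; simp
          · rw [if_neg hmi, if_neg (fun e => hmi (Nat.succPNat_injective e)), zero_mul]
        · congr 2; ring
      rw [Finset.sum_congr rfl e, Finset.sum_add_distrib, Finset.sum_ite_eq]
      rcases le_or_gt (m + 1) (r + 1) with hm | hm
      · rw [if_pos (Finset.mem_range.2 (by omega))]
        obtain ⟨d, rfl⟩ : ∃ d, r = m + d := ⟨r - m, by omega⟩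
        -- With d = r - m this is Newton's recursion for d h_d, padded by terms of negative index.
        -- Together with (m + 1) h_d it makes (r + 1) h_d.
        have e2 : ∑ i ∈ Finset.range (m + d + 1),
            p (Nat.succPNat i) * h (((m + d : ℕ) : ℤ) - (m + 1) - i) = (d : Coef) • h (d : ℤ) := by
          cases d with
          | zero =>
            rw [Nat.cast_zero, zero_smul]
            exact Finset.sum_eq_zero fun i _ => by rw [h_of_neg (by push_cast; omega), mul_zero]
          | succ d =>
            rw [h_natCast, Nat.cast_succ, hNat_succ]
            symm
            refine (Finset.sum_subset (Finset.range_subset_range.2 (by omega)) fun i hi hi' => ?_).trans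
              (Finset.sum_congr rfl fun i _ => ?_)
            · have : d + 1 ≤ i := by simpa using hi'
              rw [h_of_neg (by omega), mul_zero]
            · congr 2; push_cast; ring
        rw [e2]
        simp only [MvPolynomial.smul_eq_C_mul]
        push_cast
        rw [show ((m : ℤ) + d - m) = d by ring, show (m : ℤ) + d + 1 - (m + 1) = d by ring]
        simp only [map_add, map_natCast, map_one]
        ring
      · rw [if_neg (fun e => by have := Finset.mem_range.1 e; omega), zero_add,
          h_of_neg (by push_cast; omega), smul_zero]
        exact Finset.sum_eq_zero fun i _ => by rw [h_of_neg (by omega), mul_zero]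

/-- The coefficients of `h_n[X + c y]`, where `∑ w_j y^j = exp (∑ c_k y^k / k)`. -/
theorem skew_h {c : ℕ+ → Coef} {w : ℕ → Coef} (w0 : w 0 = 1)
    (hw : ∀ r : ℕ, ((r : Coef) + 1) * w (r + 1) =
      ∑ i ∈ Finset.range (r + 1), c (Nat.succPNat i) * w (r - i)) (j : ℕ) (n : ℤ) :
    skew c j (h n) = w j • h (n - j) := by
  induction j using Nat.strong_induction_on generalizing n with
  | _ j ih =>
    cases j with
    | zero => simp [skew_zero, w0]
    | succ r =>
      have hr := natCast_add_one_ne_zero r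
      rw [← (smul_right_injective Sym hr).eq_iff]
      rw [skew_succ, smul_smul, hw, Finset.sum_smul, Fin.sum_univ_eq_sum_range
        (fun i => c (Nat.succPNat i) • skew c (r - i) (perp (p (Nat.succPNat i)) (h n)))]
      refine Finset.sum_congr rfl fun i hi => ?_
      have := Finset.mem_range.1 hi
      rw [perp_p_h, ih _ (by omega), smul_smul]
      congr 2
      rw [Nat.cast_sub (by omega)]
      push_cast
      ring

/-! ### The operators `f ↦ ∑ h_{i+r} (h_i[cX])^⊥ f` -/

/-- The linear map `a y^i ↦ h_{i+r} a`. -/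
def hPair (r : ℤ) : Sym[X] →ₗ[Coef] Sym :=
  Polynomial.lsum fun i => LinearMap.mulLeft Coef (h ((i : ℤ) + r))

theorem hPair_eq_sum (r : ℤ) {g : Sym[X]} {N : ℕ} (hN : ∀ i ≥ N, g.coeff i = 0) :
    hPair r g = ∑ i ∈ Finset.range N, h ((i : ℤ) + r) * g.coeff i := by
  refine Polynomial.sum_eq_of_subset _ (fun i => by simp) fun i hi => ?_
  refine Finset.mem_range.2 ?_
  by_contra hlt
  exact Polynomial.mem_support_iff.1 hi (hN i (by omega))

theorem hPair_monomial (r : ℤ) (i : ℕ) (a : Sym) :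
    hPair r (Polynomial.monomial i a) = h ((i : ℤ) + r) * a :=
  Polynomial.sum_monomial_index _ _ (by simp)

theorem hPair_mul_X_pow (r : ℤ) (k : ℕ) (g : Sym[X]) :
    hPair r (g * Polynomial.X ^ k) = hPair (r + k) g := by
  induction g using Polynomial.induction_on' with
  | add f g hf hg => rw [add_mul, map_add, map_add, hf, hg]
  | monomial i a =>
    rw [Polynomial.monomial_mul_X_pow, hPair_monomial, hPair_monomial]
    congr 2
    push_cast
    ring

/-- The operator `f ↦ ∑_i h_{i+r} (h_i[cX])^⊥ f`. -/
def bern (c : ℕ+ → Coef) (r : ℤ) : Sym →ₗ[Coef] Sym := hPair r ∘ₗ (shiftHom c).toLinearMap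

theorem bern_apply (c : ℕ+ → Coef) (r : ℤ) (f : Sym) : bern c r f = hPair r (shiftHom c f) := rfl

theorem exists_skew_eq_zero (c : ℕ+ → Coef) (f : Sym) : ∃ N, ∀ i ≥ N, skew c i f = 0 :=
  ⟨(shiftHom c f).natDegree + 1, fun _ hi =>
    Polynomial.coeff_eq_zero_of_natDegree_lt (Nat.lt_of_succ_le hi)⟩

theorem bern_eq_sum {c : ℕ+ → Coef} (r : ℤ) {f : Sym} {N : ℕ} (hN : ∀ i ≥ N, skew c i f = 0) :
    bern c r f = ∑ i ∈ Finset.range N, h ((i : ℤ) + r) * skew c i f :=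
  hPair_eq_sum r hN

theorem vertexOp_eq_bern (l : ℤ) (f : Sym) :
    vertexOp l f = bern (fun k => t ^ (k : ℕ) - 1) l f := by
  obtain ⟨N, hN⟩ := exists_skew_eq_zero (fun k => t ^ (k : ℕ) - 1) f
  have e : ∀ i : ℕ, perp (plethMul (h i)) f = skew (fun k => t ^ (k : ℕ) - 1) i f := fun i => by
    rw [skew_eq_perp, h_natCast]; rfl
  rw [bern_eq_sum l hN, vertexOp]
  simp only [e]
  refine finsum_eq_sum_of_support_subset _ fun i hi => ?_
  rw [Finset.mem_coe, Finset.mem_range]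
  by_contra hlt
  exact hi (by simp only [hN i (by omega), mul_zero])

/-- Translate by c'y first, then by cy with the same variable y. -/
theorem shiftHom_add (c c' : ℕ+ → Coef) (f : Sym) {N : ℕ} (hN : ∀ i ≥ N, skew c' i f = 0) :
    shiftHom (c + c') f =
      ∑ k ∈ Finset.range N, shiftHom c (skew c' k f) * Polynomial.X ^ k := by
  have h1 : (shiftHom (c + c')).toRingHom =
      (Polynomial.eval₂RingHom (shiftHom c).toRingHom Polynomial.X).comp
        (shiftHom c').toRingHom := by
    refine MvPolynomial.ringHom_ext (fun a => ?_) fun k => ?_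
    · change shiftHom _ _ = Polynomial.eval₂ _ _ (shiftHom _ _)
      rw [shiftHom_C, shiftHom_C, Polynomial.eval₂_C]
      exact (shiftHom_C _ _).symm
    · change shiftHom _ (p k) = Polynomial.eval₂ _ _ (shiftHom _ (p k))
      rw [shiftHom_p, shiftHom_p, Polynomial.eval₂_add, Polynomial.eval₂_mul, Polynomial.eval₂_C,
        Polynomial.eval₂_C, Polynomial.eval₂_X_pow]
      change _ = shiftHom c (p k) + shiftHom c (MvPolynomial.C _) * _
      rw [shiftHom_p, shiftHom_C, Pi.add_apply, map_add, map_add]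
      ring
  have h2 : shiftHom (c + c') f =
      Polynomial.eval₂ (shiftHom c).toRingHom Polynomial.X (shiftHom c' f) :=
    congrArg (fun F => F f) h1
  rw [h2, Polynomial.eval₂_eq_sum]
  refine Polynomial.sum_eq_of_subset _ (fun i => by simp) fun i hi => ?_
  refine Finset.mem_range.2 ?_
  by_contra hlt
  exact Polynomial.mem_support_iff.1 hi (hN i (by omega))

theorem bern_add (c c' : ℕ+ → Coef) (r : ℤ) (f : Sym) {N : ℕ} (hN : ∀ i ≥ N, skew c' i f = 0) :
    bern (c + c') r f = ∑ k ∈ Finset.range N, bern c (r + k) (skew c' k f) := by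
  rw [bern_apply, shiftHom_add c c' f hN, map_sum]
  exact Finset.sum_congr rfl fun k _ => hPair_mul_X_pow r k _

theorem bern_zero (r : ℤ) (f : Sym) : bern 0 r f = h r * f := by
  have h1 : shiftHom 0 f = Polynomial.C f := by
    have : (shiftHom 0).toRingHom = Polynomial.C := by
      refine MvPolynomial.ringHom_ext (fun a => shiftHom_C _ _) fun k => ?_
      refine (shiftHom_p 0 k).trans ?_
      simp [p]
    exact congrArg (fun F => F f) this
  rw [bern_apply, h1, ← Polynomial.monomial_zero_left, hPair_monomial, Nat.cast_zero, zero_add]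

theorem shiftHom_one (c : ℕ+ → Coef) : shiftHom c 1 = 1 := map_one _

theorem skew_one (c : ℕ+ → Coef) {k : ℕ} (hk : k ≠ 0) : skew c k 1 = 0 := by
  rw [skew_apply, shiftHom_one, Polynomial.coeff_one, if_neg hk]

theorem bern_one (c : ℕ+ → Coef) (r : ℤ) : bern c r 1 = h r := by
  rw [bern_apply, shiftHom_one, ← Polynomial.monomial_zero_one, hPair_monomial]
  simp

/-- Skewing operators commute with one another and act on a product by convolution, so only their
effect on the factors h_{m+l} shifts the index. -/
theorem skew_bern {c c' : ℕ+ → Coef} {w : ℕ → Coef}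
    (hw : ∀ (j : ℕ) (n : ℤ), skew c j (h n) = w j • h (n - j)) (k : ℕ) (l : ℤ) (f : Sym) :
    skew c k (bern c' l f) =
      ∑ x ∈ Finset.HasAntidiagonal.antidiagonal k, w x.1 • bern c' (l - x.1) (skew c x.2 f) := by
  obtain ⟨N, hN⟩ := exists_skew_eq_zero c' f
  have e1 : ∀ i r, bern c' r (skew c i f) =
      ∑ m ∈ Finset.range N, h ((m : ℤ) + r) * skew c i (skew c' m f) := fun i r => by
    rw [bern_eq_sum r (N := N) fun m hm => by rw [skew_comm, hN m hm, map_zero]]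
    exact Finset.sum_congr rfl fun m _ => by rw [skew_comm]
  rw [bern_eq_sum l hN, map_sum]
  simp only [skew_mul, hw, e1, Finset.smul_sum]
  rw [Finset.sum_comm]
  refine Finset.sum_congr rfl fun x _ => Finset.sum_congr rfl fun m _ => ?_
  rw [smul_mul_assoc, add_sub_assoc]

/-- The alphabet `1 - s`. -/
def oneSub (s : Coef) : ℕ+ → Coef := fun k => 1 - s ^ (k : ℕ)

/-- The vertex operator `∑_i h_{i+r} (h_i[(s-1)X])^⊥`: Bernstein's operator for `s = 0`. -/
def vertex (s : Coef) (r : ℤ) : Sym →ₗ[Coef] Sym := bern (-oneSub s) r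

theorem vertexOp_eq (l : ℤ) (f : Sym) : vertexOp l f = vertex t l f := by
  rw [vertexOp_eq_bern, vertex]
  congr 2
  ext k
  simp [oneSub]

theorem vertex_one (s : Coef) (r : ℤ) : vertex s r 1 = h r := bern_one _ _

/-- The generating function is exp Σ (1 - s^k) y^k/k = (1 - sy)/(1 - y), with coefficients 1, 1 - s,
1 - s, …. -/
theorem skew_oneSub_h (s : Coef) (j : ℕ) (n : ℤ) :
    skew (oneSub s) j (h n) = (if j = 0 then 1 else 1 - s) • h (n - j) := by
  refine skew_h (w := fun j => if j = 0 then 1 else 1 - s) (if_pos rfl) (fun r => ?_) j n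
  have h1 : ∀ r : ℕ, ∑ i ∈ Finset.range r, oneSub s (Nat.succPNat i) * (1 - s) =
      r * (1 - s) - s * (1 - s ^ r) := by
    intro r
    induction r with
    | zero => simp
    | succ r ih =>
      rw [Finset.sum_range_succ, ih]
      simp only [oneSub, Nat.succPNat_coe, Nat.succ_eq_add_one]
      push_cast
      ring
  rw [if_neg (Nat.succ_ne_zero r), Finset.sum_range_succ, Nat.sub_self, if_pos rfl,
    Finset.sum_congr rfl (g := fun i => oneSub s (Nat.succPNat i) * (1 - s)), h1]
  · simp only [oneSub, Nat.succPNat_coe, Nat.succ_eq_add_one]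
    ring
  · intro i hi
    have := Finset.mem_range.1 hi
    rw [if_neg (by omega)]

/-- By `skew_bern` the left side is V_l(f_k) + (1 - s) Σ_{j ≥ 1} V_{l-j}(f_{k-j}), where f_i is the
skewing of f. The alphabets of V and of the skewing cancel, so the full sum over j ≥ 0 is
multiplication of f by h_{l-k}. The vanishing hypothesis is what cuts that full sum off at i = k. -/
theorem skew_vertex (s : Coef) (k : ℕ) (l : ℤ) (f : Sym)
    (hf : ∀ i > k, skew (oneSub s) i f = 0) :
    skew (oneSub s) k (vertex s l f) =
      (1 - s) • (h (l - k) * f) + s • vertex s l (skew (oneSub s) k f) := by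
  have h0 := bern_add (-oneSub s) (oneSub s) (l - k) f (N := k + 1) fun i hi => hf i hi
  rw [neg_add_cancel, bern_zero] at h0
  rw [vertex, skew_bern (skew_oneSub_h s), h0, ← Finset.Nat.sum_antidiagonal_swap,
    Finset.Nat.sum_antidiagonal_eq_sum_range_succ_mk, Finset.sum_range_succ,
    Finset.sum_range_succ]
  simp only [Prod.fst_swap, Prod.snd_swap, Nat.sub_self, if_true, one_smul]
  rw [Nat.cast_zero, sub_zero, sub_add_cancel, smul_add, add_assoc, ← add_smul, sub_add_cancel,
    one_smul, Finset.smul_sum]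
  congr 1
  refine Finset.sum_congr rfl fun i hi => ?_
  have := Finset.mem_range.1 hi
  rw [if_neg (by omega), Nat.cast_sub (by omega)]
  congr 3
  ring

/-! ### Orthogonality -/

/-- `V_{a_1} ∘ ⋯ ∘ V_{a_m} 1` for the vertex operators `V` with parameter `s`. -/
def vertexWord (s : Coef) (a : List ℤ) : Sym := a.foldr (fun r f => vertex s r f) 1

theorem vertexWord_nil (s : Coef) : vertexWord s [] = 1 := rfl

theorem vertexWord_cons (s : Coef) (r : ℤ) (a : List ℤ) :
    vertexWord s (r :: a) = vertex s r (vertexWord s a) := rfl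

/-- The words indexed by partitions. -/
def vertexPart (s : Coef) (a : List ℕ) : Sym := vertexWord s (a.map (↑))

theorem vertexPart_nil (s : Coef) : vertexPart s [] = 1 := rfl

theorem vertexPart_cons (s : Coef) (r : ℕ) (a : List ℕ) :
    vertexPart s (r :: a) = vertex s r (vertexPart s a) := rfl

theorem skew_vertexPart_eq_zero (s : Coef) {a : List ℕ} (ha : a.SortedGE) {k : ℕ} (hk0 : 0 < k)
    (hk : ∀ x ∈ a, x < k) : skew (oneSub s) k (vertexPart s a) = 0 := by
  induction a generalizing k with
  | nil => exact skew_one _ hk0.ne'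
  | cons l a ih =>
    rw [List.sortedGE_iff_pairwise, List.pairwise_cons] at ha
    have h1 : ∀ i ≥ k, skew (oneSub s) i (vertexPart s a) = 0 := fun i hi =>
      ih ha.2.sortedGE (by omega) fun x hx => (hk x (by simp [hx])).trans_le hi
    have hl := hk l (by simp)
    rw [vertexPart_cons, skew_vertex s k l _ fun i hi => h1 i hi.le, h1 k le_rfl,
      h_of_neg (by omega)]
    simp

/-- Each further copy of l changes the scalar by x ↦ (1 - s) + s x, by `skew_vertex`. Starting from
0, m copies give 1 - s^m. -/
theorem skew_vertexPart (s : Coef) {l : ℕ} {a : List ℕ} (ha : (l :: a).SortedGE) (hl : 0 < l) :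
    skew (oneSub s) l (vertexPart s (l :: a)) =
      (1 - s ^ ((l :: a).count l)) • vertexPart s a := by
  induction a with
  | nil =>
    rw [vertexPart_cons, vertexPart_nil, skew_vertex s l l _ fun i hi => skew_one _ (by omega),
      skew_one _ hl.ne']
    simp [h_zero]
  | cons l' a ih =>
    have h' := List.sortedGE_iff_pairwise.1 ha
    rw [List.pairwise_cons] at h'
    have h1 : ∀ i > l, skew (oneSub s) i (vertexPart s (l' :: a)) = 0 := fun i hi =>
      skew_vertexPart_eq_zero s h'.2.sortedGE (by omega) fun x hx => (h'.1 x hx).trans_lt hi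
    rw [vertexPart_cons, skew_vertex s l l _ h1, sub_self, h_zero, one_mul, List.count_cons_self]
    rcases (h'.1 l' (by simp)).lt_or_eq with hlt | rfl
    · rw [skew_vertexPart_eq_zero s h'.2.sortedGE hl, List.count_eq_zero_of_not_mem]
      · simp
      · intro hm
        have h2 := List.pairwise_cons.1 h'.2
        rcases List.mem_cons.1 hm with rfl | hm
        · omega
        · have := h2.1 l hm; omega
      · intro x hx
        have h2 := List.pairwise_cons.1 h'.2
        rcases List.mem_cons.1 hx with rfl | hx
        · omega
        · have := h2.1 x hx; omega
    · rw [ih h'.2.sortedGE, map_smul, smul_smul, ← vertexPart_cons, ← add_smul]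
      congr 1
      ring

theorem hall_mul_left (f g u : Sym) : hall (f * g) u = hall g (perp f u) := by
  rw [hall_comm, ← hall_perp, hall_comm]

/-- Moving h_{i+l}[X(1-s)] to the other side skews g in degree i + l, which kills g unless i = 0. -/
theorem hall_pleth_vertex (s : Coef) (l : ℕ) (f g : Sym)
    (hg : ∀ i > l, skew (oneSub s) i g = 0) :
    hall (pleth (oneSub s) (vertex s l f)) g =
      hall (pleth (oneSub s) f) (skew (oneSub s) l g) := by
  obtain ⟨N, hN⟩ := exists_skew_eq_zero (-oneSub s) f
  rw [vertex, bern_eq_sum l (N := N + 1) fun i hi => hN i (by omega), map_sum, map_sum,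
    LinearMap.sum_apply, Finset.sum_eq_single_of_mem 0 (by simp)]
  · rw [map_mul, hall_mul_left, skew_zero, skew_eq_perp, ← h_natCast, Nat.cast_zero, zero_add]
  · intro i _ hi
    rw [map_mul, hall_mul_left, ← Nat.cast_add, h_natCast, ← skew_eq_perp, hg _ (by omega),
      map_zero]

/-- The product `∏ (1 - s^j)` over the multiplicities of the parts. -/
def normCoef (s : Coef) : List ℕ → Coef
  | [] => 1
  | l :: a => (1 - s ^ ((l :: a).count l)) * normCoef s a

theorem hall_pleth_vertexPart_self (s : Coef) {a : List ℕ} (ha : IsPartition a) :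
    hall (pleth (oneSub s) (vertexPart s a)) (vertexPart s a) = normCoef s a := by
  induction a with
  | nil =>
    rw [vertexPart_nil, map_one (pleth _), show (1 : Sym) = pMon 0 from rfl, hall, scalar_pMon, if_pos rfl]
    rfl
  | cons l a ih =>
    have h' := List.pairwise_cons.1 (List.sortedGE_iff_pairwise.1 ha.1)
    conv_lhs => enter [1, 2]; rw [vertexPart_cons]
    rw [hall_pleth_vertex, skew_vertexPart s ha.1 (ha.2 l (by simp)), map_smul,
      ih ⟨h'.2.sortedGE, fun x hx => ha.2 x (by simp [hx])⟩]
    · rfl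
    · intro i hi
      refine skew_vertexPart_eq_zero s ha.1 (by omega) fun x hx => ?_
      rcases List.mem_cons.1 hx with rfl | hx
      · exact hi
      · exact (h'.1 x hx).trans_lt hi

theorem hall_pleth_oneSub_comm (s : Coef) (f g : Sym) :
    hall (pleth (oneSub s) f) g = hall (pleth (oneSub s) g) f := by
  rw [hall_comm, hall_pleth_right]

/-- Strip off the larger first part: skewing in that degree annihilates the other word. If the first
parts agree, both words lose one part and induction applies. -/
theorem hall_pleth_vertexPart_of_ne (s : Coef) {a b : List ℕ} (ha : IsPartition a)
    (hb : IsPartition b) (hab : a ≠ b) :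
    hall (pleth (oneSub s) (vertexPart s a)) (vertexPart s b) = 0 := by
  have key : ∀ (l : ℕ) (a b : List ℕ), 0 < l → IsPartition b → (∀ x ∈ b, x < l) →
      hall (pleth (oneSub s) (vertexPart s (l :: a))) (vertexPart s b) = 0 := by
    intro l a b hl hb hlt
    have h1 : ∀ i ≥ l, skew (oneSub s) i (vertexPart s b) = 0 := fun i hi =>
      skew_vertexPart_eq_zero s hb.1 (by omega) fun x hx => (hlt x hx).trans_le hi
    rw [vertexPart_cons, hall_pleth_vertex s l _ _ fun i hi => h1 i hi.le, h1 l le_rfl, map_zero]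
  have tail : ∀ {l : ℕ} {a : List ℕ}, IsPartition (l :: a) →
      IsPartition a ∧ 0 < l ∧ ∀ x ∈ l :: a, x ≤ l := by
    intro l a ha
    have h' := List.pairwise_cons.1 (List.sortedGE_iff_pairwise.1 ha.1)
    refine ⟨⟨h'.2.sortedGE, fun x hx => ha.2 x (by simp [hx])⟩, ha.2 l (by simp), fun x hx => ?_⟩
    rcases List.mem_cons.1 hx with rfl | hx
    · exact le_rfl
    · exact h'.1 x hx
  induction a generalizing b with
  | nil =>
    cases b with
    | nil => exact absurd rfl hab
    | cons l b =>
      rw [hall_pleth_oneSub_comm]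
      exact key l b [] (tail hb).2.1 ha (by simp)
  | cons l a ih =>
    cases b with
    | nil => exact key l a [] (tail ha).2.1 hb (by simp)
    | cons l' b =>
      rcases lt_trichotomy l l' with hlt | rfl | hlt
      · rw [hall_pleth_oneSub_comm]
        exact key l' b _ (tail hb).2.1 ha fun x hx => ((tail ha).2.2 x hx).trans_lt hlt
      · rw [vertexPart_cons s l a, hall_pleth_vertex, skew_vertexPart s hb.1 (tail hb).2.1,
          map_smul, ih (tail ha).1 (tail hb).1 (fun e => hab (by rw [e])), smul_zero]
        exact fun i hi => skew_vertexPart_eq_zero s hb.1 (by omega)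
          fun x hx => ((tail hb).2.2 x hx).trans_lt hi
      · exact key l a _ (tail ha).2.1 hb fun x hx => ((tail hb).2.2 x hx).trans_lt hlt

/-! ### Jacobi–Trudi determinants of integer sequences -/

/-- `det (h_{a_i + j - i})`. -/
def schurFn {n : ℕ} (a : Fin n → ℤ) : Sym :=
  Matrix.det (Matrix.of fun i j : Fin n => h (a i + (j : ℤ) - (i : ℤ)))

/-- The alphabet is -1, and exp(-Σ y^k/k) = 1 - y. -/
theorem shiftHom_bernstein_h (n : ℤ) : shiftHom (-oneSub 0) (h n) =
    Polynomial.C (h n) - Polynomial.X * Polynomial.C (h (n - 1)) := by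
  have hw : ∀ j, skew (-oneSub 0) j (h n) =
      (if j = 0 then 1 else if j = 1 then -1 else 0 : Coef) • h (n - j) := fun j => by
    refine skew_h (w := fun j => if j = 0 then 1 else if j = 1 then -1 else 0) (if_pos rfl)
      (fun r => ?_) j n
    have e : ∀ i, (-oneSub 0) (Nat.succPNat i) = (-1 : Coef) := fun i => by simp [oneSub]
    simp only [e, ← Finset.mul_sum]
    have e2 := Finset.sum_range_reflect
      (fun i => (if i = 0 then 1 else if i = 1 then -1 else 0 : Coef)) (r + 1)
    simp only [Nat.add_sub_cancel] at e2
    rw [e2]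
    cases r with
    | zero => simp
    | succ r => simp [Finset.sum_range_succ']
  ext1 j
  rw [← skew_apply, hw]
  match j with
  | 0 => simp
  | 1 => simp
  | j + 2 => simp

/-- Bernstein's formula, read off from one determinant over Λ[y] evaluated in two ways: by column
operations, and by expansion along its first row. -/
theorem vertex_zero_schurFn {n : ℕ} (r : ℤ) (a : Fin n → ℤ) :
    vertex 0 r (schurFn a) = schurFn (Fin.cons r a : Fin (n + 1) → ℤ) := by
  -- First row (1, y, y², …), above the rows of the enlarged Jacobi–Trudi matrix that come from a.
  let A : Matrix (Fin (n + 1)) (Fin (n + 1)) Sym[X] := Matrix.of fun i j =>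
    (Fin.cons (Polynomial.X ^ (j : ℕ))
      (fun i : Fin n => Polynomial.C (h (a i + (j : ℤ) - ((i : ℤ) + 1)))) : Fin (n + 1) → Sym[X]) i
  -- Subtracting y times the preceding column makes the first row (1, 0, …, 0) and the other entries
  -- h_m - y h_{m-1}, the translated h_m.
  let B : Matrix (Fin (n + 1)) (Fin (n + 1)) Sym[X] := Matrix.of fun i j =>
    (Fin.cons (A i 0) (fun j : Fin n => A i j.succ - Polynomial.X * A i j.castSucc) :
      Fin (n + 1) → Sym[X]) j
  have hAB : A.det = B.det :=
    Matrix.det_eq_of_forall_col_eq_smul_add_pred (fun _ => Polynomial.X) (fun i => by simp [B])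
      fun i j => by simp [B]
  have hB : B.det = shiftHom (-oneSub 0) (schurFn a) := by
    rw [Matrix.det_succ_row_zero, Fin.sum_univ_succ, Finset.sum_eq_zero, add_zero, schurFn]
    · have e : B 0 0 = 1 := by simp [B, A]
      rw [e, Fin.val_zero, pow_zero, one_mul, one_mul, ← AlgHom.coe_toRingHom, RingHom.map_det]
      congr 1
      ext1 i j
      simp only [Fin.succAbove_zero, Matrix.submatrix_apply, RingHom.mapMatrix_apply,
        Matrix.map_apply, Matrix.of_apply, AlgHom.coe_toRingHom, shiftHom_bernstein_h, B, A,
        Fin.cons_succ, Fin.val_succ, Fin.val_castSucc]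
      have e1 : a i + ((j.val + 1 : ℕ) : ℤ) - ((i : ℤ) + 1) = a i + (j : ℤ) - (i : ℤ) := by
        push_cast; ring
      have e2 : a i + (j : ℤ) - ((i : ℤ) + 1) = a i + (j : ℤ) - (i : ℤ) - 1 := by ring
      rw [e1, e2]
    · intro j _
      have e : B 0 j.succ = 0 := by simp [B, A, pow_succ']
      rw [e]
      simp
  -- In the expansion of A along its first row, `hPair r` replaces y^j by h_{r+j}, the first row of
  -- the Jacobi–Trudi matrix of (r, a).
  rw [vertex, bern_apply, ← hB, ← hAB, Matrix.det_succ_row_zero, schurFn,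
    Matrix.det_succ_row_zero, map_sum]
  refine Finset.sum_congr rfl fun j _ => ?_
  have e1 : (A.submatrix Fin.succ j.succAbove).det = Polynomial.C ((Matrix.of fun i j : Fin (n + 1) =>
      h ((Fin.cons r a : Fin (n + 1) → ℤ) i + (j : ℤ) - (i : ℤ))).submatrix
        Fin.succ j.succAbove).det := by
    rw [RingHom.map_det]
    refine congrArg Matrix.det (Matrix.ext fun i k => ?_)
    simp only [Matrix.submatrix_apply, RingHom.mapMatrix_apply, Matrix.map_apply,
      Matrix.of_apply, A, Fin.cons_succ, Fin.val_succ]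
    push_cast
    rfl
  rw [e1]
  have e2 : A 0 j = Polynomial.X ^ (j : ℕ) := by simp [A]
  rw [e2]
  generalize ((Matrix.of fun i j : Fin (n + 1) =>
      h ((Fin.cons r a : Fin (n + 1) → ℤ) i + (j : ℤ) - (i : ℤ))).submatrix
        Fin.succ j.succAbove).det = d
  have e3 : (-1 : Sym[X]) ^ (j : ℕ) * Polynomial.X ^ (j : ℕ) * Polynomial.C d =
      Polynomial.monomial (j : ℕ) ((-1) ^ (j : ℕ) * d) := by
    rw [← Polynomial.C_mul_X_pow_eq_monomial]
    simp only [map_mul, map_pow, map_neg, map_one]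
    ring
  rw [e3, hPair_monomial]
  simp only [Matrix.of_apply, Fin.cons_zero, Fin.val_zero]
  rw [show (j : ℤ) + r = r + (j : ℤ) - ((0 : ℕ) : ℤ) by push_cast; ring]
  ring

theorem vertexWord_ofFn {n : ℕ} (a : Fin n → ℤ) : vertexWord 0 (List.ofFn a) = schurFn a := by
  induction n with
  | zero => simp [vertexWord_nil, schurFn]
  | succ n ih =>
    rw [List.ofFn_succ, vertexWord_cons, ih, vertex_zero_schurFn]
    congr 1
    exact Fin.cons_self_tail a

theorem schurL_eq (l : List ℕ) : schurL l = vertexPart 0 l := by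
  have e : schurL l = schurFn fun i => (l.get i : ℤ) := rfl
  rw [e, ← vertexWord_ofFn, vertexPart]
  congr 1
  apply List.ext_get <;> simp

/-! ### Straightening -/

/-- Sorting does not decrease the partial sums. -/
theorem sum_filter_le_of_antitone {n : ℕ} (α : Fin n → ℤ) (σ : Equiv.Perm (Fin n))
    (hσ : Antitone (α ∘ σ)) (k : ℕ) :
    ∑ i with i.val < k, α i ≤ ∑ i with i.val < k, α (σ i) := by
  have hf : Antitone fun i : Fin n => if i.val < k then (1 : ℤ) else 0 := by
    intro i j hij
    have : i.val ≤ j.val := hij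
    dsimp only
    split_ifs <;> omega
  -- Rearrangement inequality against the indicator of the first k positions.
  have h1 := (hf.monovary hσ).sum_mul_comp_perm_le_sum_mul (σ := σ⁻¹)
  simpa [Finset.sum_filter] using h1

/-- With α_i = a_i - i, permuting the rows of the Jacobi–Trudi determinant permutes α up to sign.
Equal entries of α give equal rows; otherwise α can be sorted into strictly decreasing order. -/
theorem vertexWord_zero_sort (b : List ℤ) : vertexWord 0 b = 0 ∨ ∃ c : List ℤ,
    c.SortedGE ∧ c.sum = b.sum ∧ (∀ k, (b.take k).sum ≤ (c.take k).sum) ∧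
      (vertexWord 0 b = vertexWord 0 c ∨ vertexWord 0 b = -vertexWord 0 c) := by
  obtain ⟨n, a, rfl⟩ : ∃ (n : ℕ) (a : Fin n → ℤ), b = List.ofFn a :=
    ⟨_, b.get, (List.ofFn_get b).symm⟩
  let α : Fin n → ℤ := fun i => a i - i
  rw [vertexWord_ofFn]
  by_cases hinj : Function.Injective α
  · right
    obtain ⟨σ, hσ⟩ : ∃ σ : Equiv.Perm (Fin n), Antitone (α ∘ σ) :=
      ⟨Tuple.sort (-α), fun i j hij => neg_le_neg_iff.1 (Tuple.monotone_sort (-α) hij)⟩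
    have hσ' : StrictAnti (α ∘ σ) := hσ.strictAnti_of_injective (hinj.comp σ.injective)
    -- Adding the staircase back to a strictly decreasing integer sequence leaves a weakly
    -- decreasing one.
    let μ : Fin n → ℤ := fun i => α (σ i) + i
    have hμ : Antitone μ := by
      cases n with
      | zero => exact fun i => i.elim0
      | succ n =>
        refine Fin.antitone_iff_succ_le.2 fun i => ?_
        have h1 : α (σ i.succ) < α (σ i.castSucc) := hσ' i.castSucc_lt_succ
        change α (σ i.succ) + (i.succ : ℕ) ≤ α (σ i.castSucc) + (i.castSucc : ℕ)
        rw [Fin.val_succ, Fin.val_castSucc]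
        push_cast
        omega
    have hdet : schurFn μ = (Equiv.Perm.sign σ : ℤ) * schurFn a := by
      rw [schurFn, schurFn, ← Matrix.det_permute]
      congr 1
      ext1 i j
      simp only [Matrix.submatrix_apply, Matrix.of_apply, μ, α, id]
      congr 1
      ring
    have hsum : ∀ k, ∑ i with i.val < k, μ i = ∑ i with i.val < k, α (σ i) +
        ∑ i : Fin n with i.val < k, (i : ℤ) := fun k => Finset.sum_add_distrib
    have hsum' : ∀ k, ∑ i with i.val < k, a i = ∑ i with i.val < k, α i +
        ∑ i : Fin n with i.val < k, (i : ℤ) := fun k => by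
      rw [← Finset.sum_add_distrib]
      exact Finset.sum_congr rfl fun i _ => by simp [α]
    refine ⟨List.ofFn μ, ?_, ?_, fun k => ?_, ?_⟩
    · exact (List.sortedGE_ofFn_iff).2 hμ
    · rw [List.sum_ofFn, List.sum_ofFn]
      have e1 : ∑ i, α (σ i) = ∑ i, α i := Equiv.sum_comp σ α
      have e2 : ∑ i, a i = ∑ i, α i + ∑ i : Fin n, (i : ℤ) := by
        rw [← Finset.sum_add_distrib]
        exact Finset.sum_congr rfl fun i _ => by simp [α]
      rw [e2, ← e1, ← Finset.sum_add_distrib]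
    · rw [List.sum_take_ofFn, List.sum_take_ofFn, hsum, hsum']
      exact add_le_add_left (sum_filter_le_of_antitone α σ hσ k) _
    · rw [vertexWord_ofFn, hdet]
      rcases Int.units_eq_one_or (Equiv.Perm.sign σ) with e | e <;> simp [e]
  · left
    obtain ⟨i, j, hij, hne⟩ : ∃ i j, α i = α j ∧ i ≠ j := by
      simpa [Function.Injective] using hinj
    refine Matrix.det_zero_of_row_eq hne ?_
    ext1 k
    simp only [Matrix.of_apply]
    congr 1
    have : a i - i = a j - j := hij
    linarith

theorem vertexWord_append (s : Coef) (a b : List ℤ) :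
    vertexWord s (a ++ b) = a.foldr (fun r f => vertex s r f) (vertexWord s b) := by
  rw [vertexWord, List.foldr_append, ← vertexWord]

theorem vertexWord_append_zeros (s : Coef) (a : List ℤ) (k : ℕ) :
    vertexWord s (a ++ List.replicate k 0) = vertexWord s a := by
  have : vertexWord s (List.replicate k 0) = 1 := by
    induction k with
    | zero => rfl
    | succ k ih => rw [List.replicate_succ, vertexWord_cons, ih, vertex_one, h_zero]
  rw [vertexWord_append, this]; rfl

/-- If the last entry x is negative, the innermost factor is h_x = 0. Otherwise the sequence is a
partition followed by zeros. -/
theorem sortedGE_cases (s : Coef) (c : List ℤ) (hc : c.SortedGE) : vertexWord s c = 0 ∨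
    ∃ (m : List ℕ) (k : ℕ), IsPartition m ∧ c = m.map (↑) ++ List.replicate k (0 : ℤ) := by
  induction c with
  | nil => exact Or.inr ⟨[], 0, ⟨List.Pairwise.nil.sortedGE, by simp⟩, rfl⟩
  | cons x c ih =>
    have hc' := List.pairwise_cons.1 (List.sortedGE_iff_pairwise.1 hc)
    rcases ih hc'.2.sortedGE with h0 | ⟨m, k, hm, rfl⟩
    · left
      rw [vertexWord_cons, h0, map_zero]
    · rcases lt_trichotomy x 0 with hx | rfl | hx
      · left
        have hm' : m = [] := by
          refine List.eq_nil_iff_forall_not_mem.2 fun y hy => ?_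
          have := hc'.1 (y : ℤ) (List.mem_append_left _ (List.mem_map_of_mem hy))
          omega
        have hk : k = 0 := by
          by_contra hk
          have := hc'.1 0 (List.mem_append_right _ (List.mem_replicate.2 ⟨hk, rfl⟩))
          omega
        subst hm' hk
        rw [vertexWord_cons]
        exact (vertex_one s x).trans (h_of_neg hx)
      · right
        have hm' : m = [] := by
          refine List.eq_nil_iff_forall_not_mem.2 fun y hy => ?_
          have := hc'.1 (y : ℤ) (List.mem_append_left _ (List.mem_map_of_mem hy))
          have := hm.2 y hy
          omega
        subst hm'
        exact ⟨[], k + 1, hm, rfl⟩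
      · right
        lift x to ℕ using hx.le
        refine ⟨x :: m, k, ⟨List.Pairwise.sortedGE (List.pairwise_cons.2 ⟨fun y hy => ?_,
          List.sortedGE_iff_pairwise.1 hm.1⟩), fun y hy => ?_⟩, rfl⟩
        · have := hc'.1 (y : ℤ) (List.mem_append_left _ (List.mem_map_of_mem hy))
          omega
        · rcases List.mem_cons.1 hy with rfl | hy
          · omega
          · exact hm.2 y hy

theorem natCast_sum_take (m : List ℕ) (k : ℕ) :
    (((m.map (↑) : List ℤ)).take k).sum = ((m.take k).sum : ℕ) := by
  rw [← List.map_take, Nat.cast_list_sum]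

theorem vertexWord_zero_straighten (b : List ℤ) : vertexWord 0 b = 0 ∨ ∃ m : List ℕ,
    IsPartition m ∧ (m.sum : ℤ) = b.sum ∧ (∀ k, (b.take k).sum ≤ ((m.take k).sum : ℕ)) ∧
      (vertexWord 0 b = schurL m ∨ vertexWord 0 b = -schurL m) := by
  rcases vertexWord_zero_sort b with h0 | ⟨c, hc, hsum, htake, hcb⟩
  · exact Or.inl h0
  · rcases sortedGE_cases 0 c hc with h0 | ⟨m, k, hm, rfl⟩
    · left
      rw [h0] at hcb
      simpa using hcb
    · right
      refine ⟨m, hm, ?_, fun j => (htake j).trans ?_, ?_⟩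
      · rw [← hsum, List.sum_append, List.sum_replicate, smul_zero, add_zero, Nat.cast_list_sum]
      · rw [List.take_append, List.sum_append, List.take_replicate, List.sum_replicate, smul_zero,
          add_zero, natCast_sum_take]
      · rw [vertexWord_append_zeros] at hcb
        rw [schurL_eq]
        exact hcb

/-! ### Dominance of integer sequences and triangularity -/

/-- Dominance order on integer sequences of the same length and sum. -/
def SeqDom (a b : List ℤ) : Prop :=
  a.length = b.length ∧ a.sum = b.sum ∧ ∀ k, (a.take k).sum ≤ (b.take k).sum

theorem SeqDom.trans {a b c : List ℤ} (hab : SeqDom a b) (hbc : SeqDom b c) : SeqDom a c :=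
  ⟨hab.1.trans hbc.1, hab.2.1.trans hbc.2.1, fun k => (hab.2.2 k).trans (hbc.2.2 k)⟩

theorem SeqDom.antisymm {a b : List ℤ} (hab : SeqDom a b) (hba : SeqDom b a) : a = b := by
  have h1 : ∀ k, (a.take k).sum = (b.take k).sum := fun k => le_antisymm (hab.2.2 k) (hba.2.2 k)
  refine List.ext_getElem hab.1 fun k hk hk' => ?_
  have h2 := h1 (k + 1)
  rw [List.sum_take_succ _ _ hk, List.sum_take_succ _ _ hk', h1 k] at h2
  exact add_left_cancel h2

theorem SeqDom.cons {a b : List ℤ} (hab : SeqDom a b) (r : ℤ) : SeqDom (r :: a) (r :: b) := by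
  refine ⟨congrArg (· + 1) hab.1, ?_, fun k => ?_⟩
  · rw [List.sum_cons, List.sum_cons, hab.2.1]
  · cases k with
    | zero => simp
    | succ k => simpa using hab.2.2 k

theorem SeqDom.append_right {a b : List ℤ} (hab : SeqDom a b) (c : List ℤ) :
    SeqDom (a ++ c) (b ++ c) := by
  refine ⟨by rw [List.length_append, List.length_append, hab.1], ?_, fun k => ?_⟩
  · rw [List.sum_append, List.sum_append, hab.2.1]
  · rw [List.take_append, List.take_append, List.sum_append, List.sum_append, hab.1]
    exact add_le_add_left (hab.2.2 k) _

/-- The subring `ℤ[t]` of `ℚ(t)`. -/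
def intPoly : Subring Coef := (Polynomial.aeval t : ℤ[X] →ₐ[ℤ] Coef).toRingHom.range

theorem t_mem : t ∈ intPoly := ⟨Polynomial.X, Polynomial.aeval_X _⟩

/-- The `ℤ[t]`-span of the words that strictly dominate `a`. -/
def wordsAbove (a : List ℤ) : Submodule intPoly Sym :=
  Submodule.span intPoly {f | ∃ b, SeqDom a b ∧ b ≠ a ∧ f = vertexWord 0 b}

theorem smul_mem_of_intPoly {M : Submodule intPoly Sym} {x : Coef} (hx : x ∈ intPoly) {f : Sym}
    (hf : f ∈ M) : x • f ∈ M := M.smul_mem ⟨x, hx⟩ hf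

theorem vertexWord_mem_wordsAbove {a b : List ℤ} (hab : SeqDom a b) (hne : b ≠ a) :
    vertexWord 0 b ∈ wordsAbove a := Submodule.subset_span ⟨b, hab, hne, rfl⟩

theorem wordsAbove_mono {a b : List ℤ} (hab : SeqDom a b) : wordsAbove b ≤ wordsAbove a := by
  refine Submodule.span_le.2 ?_
  rintro _ ⟨c, hbc, hne, rfl⟩
  refine vertexWord_mem_wordsAbove (hab.trans hbc) ?_
  rintro rfl
  exact hne (hab.antisymm hbc)

/-- The powers of `t`, as an alphabet. -/
def tAlph : ℕ+ → Coef := fun k => t ^ (k : ℕ)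

/-- Here exp Σ t^k y^k/k = 1/(1 - ty). -/
theorem skew_tAlph_h (j : ℕ) (n : ℤ) : skew tAlph j (h n) = t ^ j • h (n - j) := by
  refine skew_h (w := fun j => t ^ j) (pow_zero _) (fun r => ?_) j n
  rw [Finset.sum_congr rfl (g := fun _ => t ^ (r + 1))]
  · simp
  · intro i hi
    have := Finset.mem_range.1 hi
    rw [tAlph, Nat.succPNat_coe, ← pow_add]
    congr 1
    omega

theorem skew_vertex_of_skew_h {c : ℕ+ → Coef} {w : ℕ → Coef}
    (hw : ∀ (j : ℕ) (n : ℤ), skew c j (h n) = w j • h (n - j)) (s : Coef) (k : ℕ) (l : ℤ) (f : Sym) :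
    skew c k (vertex s l f) =
      ∑ x ∈ Finset.HasAntidiagonal.antidiagonal k, w x.1 • vertex s (l - x.1) (skew c x.2 f) :=
  skew_bern hw k l f

/-- The skewing operators lower the entries of a word. -/
theorem skew_tAlph_vertexWord (k : ℕ) (a : List ℤ) : skew tAlph k (vertexWord 0 a) ∈
    Submodule.span intPoly {f | ∃ b, List.Forall₂ (· ≤ ·) b a ∧ b.sum = a.sum - k ∧
      f = vertexWord 0 b} := by
  induction a generalizing k with
  | nil =>
    rcases eq_or_ne k 0 with rfl | hk
    · rw [skew_zero]
      exact Submodule.subset_span ⟨[], List.Forall₂.nil, by simp, rfl⟩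
    · rw [vertexWord_nil, skew_one _ hk]
      exact Submodule.zero_mem _
  | cons r a ih =>
    rw [vertexWord_cons, skew_vertex_of_skew_h skew_tAlph_h]
    refine Submodule.sum_mem _ fun x hx => smul_mem_of_intPoly (pow_mem t_mem _) ?_
    have hx' : x.1 + x.2 = k := Finset.HasAntidiagonal.mem_antidiagonal.1 hx
    have h1 := Submodule.mem_map_of_mem
      (f := (vertex 0 (r - x.1)).restrictScalars intPoly) (ih x.2)
    rw [Submodule.map_span] at h1
    refine Submodule.span_mono ?_ h1
    rintro _ ⟨_, ⟨b, hb, hsum, rfl⟩, rfl⟩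
    refine ⟨(r - x.1) :: b, List.Forall₂.cons (by omega) hb, ?_, rfl⟩
    rw [List.sum_cons, List.sum_cons, hsum, ← hx']
    push_cast
    ring

/-- The total is unchanged and every tail sum weakly decreases, so every initial sum weakly
increases. -/
theorem seqDom_of_forall₂ {a b : List ℤ} {r : ℤ} {k : ℕ} (hb : List.Forall₂ (· ≤ ·) b a)
    (hsum : b.sum = a.sum - k) : SeqDom (r :: a) ((r + k) :: b) := by
  refine ⟨congrArg (· + 1) hb.length_eq.symm, ?_, fun j => ?_⟩
  · rw [List.sum_cons, List.sum_cons, hsum]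
    ring
  · cases j with
    | zero => simp
    | succ j =>
      have h1 : (b.drop j).sum ≤ (a.drop j).sum := (List.forall₂_drop j hb).sum_le_sum
      have h2 := List.sum_take_add_sum_drop a j
      have h3 := List.sum_take_add_sum_drop b j
      rw [List.take_succ_cons, List.take_succ_cons, List.sum_cons, List.sum_cons]
      omega

/-- The splitting t - 1 = (0 - 1) + t of alphabets, through `bern_add`. -/
theorem vertex_t_eq_sum (r : ℤ) (f : Sym) {N : ℕ} (hN : ∀ i ≥ N, skew tAlph i f = 0) :
    vertex t r f = ∑ k ∈ Finset.range N, vertex 0 (r + k) (skew tAlph k f) := by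
  have e : -oneSub t = -oneSub 0 + tAlph := by
    ext k
    simp [oneSub, tAlph]
    ring
  rw [vertex, e, bern_add _ _ _ _ hN]
  rfl

theorem vertex_t_vertexWord (r : ℤ) (a : List ℤ) :
    vertex t r (vertexWord 0 a) - vertexWord 0 (r :: a) ∈ wordsAbove (r :: a) := by
  obtain ⟨N, hN⟩ := exists_skew_eq_zero tAlph (vertexWord 0 a)
  -- The term k = 0 is the leading word. Every other term has first entry r + k > r, hence is
  -- strictly higher.
  rw [vertex_t_eq_sum r _ (N := N + 1) fun i hi => hN i (by omega), Finset.sum_range_succ',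
    skew_zero, Nat.cast_zero, add_zero, ← vertexWord_cons, add_sub_cancel_right]
  refine Submodule.sum_mem _ fun k _ => ?_
  have h1 := Submodule.mem_map_of_mem
    (f := (vertex 0 (r + (k + 1 : ℕ))).restrictScalars intPoly) (skew_tAlph_vertexWord (k + 1) a)
  rw [Submodule.map_span] at h1
  refine Submodule.span_mono ?_ h1
  rintro _ ⟨_, ⟨b, hb, hsum, rfl⟩, rfl⟩
  refine ⟨(r + (k + 1 : ℕ)) :: b, seqDom_of_forall₂ hb hsum, fun e => ?_, rfl⟩
  have := (List.cons.inj e).1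
  push_cast at this
  omega

theorem vertex_t_mem_wordsAbove (r : ℤ) {a : List ℤ} {f : Sym} (hf : f ∈ wordsAbove a) :
    vertex t r f ∈ wordsAbove (r :: a) := by
  have h1 := Submodule.mem_map_of_mem (f := (vertex t r).restrictScalars intPoly) hf
  rw [wordsAbove, Submodule.map_span] at h1
  refine (Submodule.span_le.2 ?_ : _ ≤ wordsAbove (r :: a)) h1
  rintro _ ⟨_, ⟨b, hb, hne, rfl⟩, rfl⟩
  have h2 := wordsAbove_mono (hb.cons r) (vertex_t_vertexWord r b)
  have h3 := vertexWord_mem_wordsAbove (hb.cons r) (fun e => hne (List.cons.inj e).2)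
  have h4 := add_mem h2 h3
  rwa [sub_add_cancel] at h4

/-- Each B_r preserves strict dominance below a new first entry and adds only higher words, so
unitriangularity passes to compositions. -/
theorem vertexOps_sub_mem (a b : List ℤ) {f : Sym} (hf : f - vertexWord 0 b ∈ wordsAbove b) :
    vertexOps a f - vertexWord 0 (a ++ b) ∈ wordsAbove (a ++ b) := by
  induction a with
  | nil => exact hf
  | cons r a ih =>
    have e : vertexOps (r :: a) f = vertex t r (vertexOps a f) := vertexOp_eq _ _
    have h1 := add_mem (vertex_t_mem_wordsAbove r ih) (vertex_t_vertexWord r (a ++ b))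
    rw [map_sub, sub_add_sub_cancel] at h1
    rw [e]
    exact h1

/-- Raising operators increase a sequence in dominance order. -/
theorem seqDom_raise {n : ℕ} (a : Fin n → ℤ) (A : Finset (Fin n × Fin n))
    (hA : ∀ x ∈ A, x.1 < x.2) :
    SeqDom (List.ofFn a) (List.ofFn fun i => a i + ((A.filter fun x => x.1 = i).card : ℤ)
      - ((A.filter fun x => x.2 = i).card : ℤ)) ∧
    (A.Nonempty → (List.ofFn fun i => a i + ((A.filter fun x => x.1 = i).card : ℤ)
      - ((A.filter fun x => x.2 = i).card : ℤ)) ≠ List.ofFn a) := by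
  have hcard : ∀ (g : Fin n × Fin n → Fin n) (s : Finset (Fin n)),
      ∑ i ∈ s, ((A.filter fun x => g x = i).card : ℤ) = ((A.filter fun x => g x ∈ s).card : ℤ) := by
    intro g s
    rw [← Nat.cast_sum, Finset.card_eq_sum_card_fiberwise (f := g) (t := s)]
    · congr 1
      refine Finset.sum_congr rfl fun i hi => ?_
      rw [Finset.filter_filter]
      congr 1
      ext x
      simp only [Finset.mem_filter]
      constructor
      · rintro ⟨hx, rfl⟩; exact ⟨hx, hi, rfl⟩
      · rintro ⟨hx, -, h2⟩; exact ⟨hx, h2⟩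
    · intro x hx
      exact (Finset.mem_filter.1 hx).2
  have hsum : ∀ s : Finset (Fin n), ∑ i ∈ s, (a i + ((A.filter fun x => x.1 = i).card : ℤ)
      - ((A.filter fun x => x.2 = i).card : ℤ)) = ∑ i ∈ s, a i +
        ((A.filter fun x => x.1 ∈ s).card : ℤ) - ((A.filter fun x => x.2 ∈ s).card : ℤ) := by
    intro s
    rw [Finset.sum_sub_distrib, Finset.sum_add_distrib, hcard (fun x => x.1), hcard (fun x => x.2)]
  have hsub : ∀ k : ℕ, (A.filter fun x => x.2 ∈ Finset.univ.filter fun i : Fin n => i.val < k) ⊆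
      A.filter fun x => x.1 ∈ Finset.univ.filter fun i : Fin n => i.val < k := by
    intro k x hx
    simp only [Finset.mem_filter, Finset.mem_univ, true_and] at hx ⊢
    exact ⟨hx.1, lt_trans (hA x hx.1) hx.2⟩
  refine ⟨⟨by simp, ?_, fun k => ?_⟩, ?_⟩
  · rw [List.sum_ofFn, List.sum_ofFn, hsum]
    simp
  · rw [List.sum_take_ofFn, List.sum_take_ofFn, hsum]
    have := Finset.card_le_card (hsub k)
    omega
  · rintro ⟨x, hx⟩ e
    have e1 := congrArg (fun l => (l.take (x.1.val + 1)).sum) e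
    rw [List.sum_take_ofFn, List.sum_take_ofFn, hsum] at e1
    -- Cutting just after the raised index of x separates it from the lowered one, so this initial
    -- sum strictly increases.
    have hlt := Finset.card_lt_card
      (Finset.ssubset_iff_subset_ne.2 ⟨hsub (x.1.val + 1), fun e2 => ?_⟩)
    · omega
    · have h1 : x ∈ A.filter fun y => y.1 ∈ Finset.univ.filter
          fun i : Fin n => i.val < x.1.val + 1 := by simp [hx]
      rw [← e2] at h1
      simp only [Finset.mem_filter, Finset.mem_univ, true_and] at h1
      have h2 : x.1.val < x.2.val := hA x hx
      omega

theorem partOp_sub_mem (l : List ℕ) (b : List ℤ) {f : Sym}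
    (hf : f - vertexWord 0 b ∈ wordsAbove b) :
    partOp l f - vertexWord 0 (l.map (↑) ++ b) ∈ wordsAbove (l.map (↑) ++ b) := by
  have hl : (l.map (↑) : List ℤ) = List.ofFn fun i : Fin l.length => (l.get i : ℤ) := by
    apply List.ext_get <;> simp
  -- The empty set of pairs carries the leading word; every nonempty set raises the index sequence
  -- strictly.
  rw [partOp, ← Finset.add_sum_erase _ _ (Finset.empty_mem_powerset _), add_sub_right_comm]
  refine add_mem ?_ (Submodule.sum_mem _ fun A hA => smul_mem_of_intPoly
    (pow_mem (neg_mem t_mem) _) ?_)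
  · have h1 := vertexOps_sub_mem (List.ofFn fun i : Fin l.length => (l.get i : ℤ)) b hf
    rw [← hl] at h1
    simpa [← hl] using h1
  · rw [Finset.mem_erase, Finset.mem_powerset] at hA
    obtain ⟨hd, hne⟩ := seqDom_raise (fun i : Fin l.length => (l.get i : ℤ)) A
      fun x hx => (Finset.mem_filter.1 (hA.2 hx)).2
    rw [← hl] at hd hne
    have hd' := hd.append_right b
    have h1 := wordsAbove_mono hd' (vertexOps_sub_mem _ b hf)
    have h2 := vertexWord_mem_wordsAbove hd' fun e =>
      hne (Finset.nonempty_iff_ne_empty.2 hA.1) (List.append_cancel_right e)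
    have h3 := add_mem h1 h2
    rwa [sub_add_cancel] at h3

theorem genSchur_sub_mem (S : List (List ℕ)) :
    genSchur S - vertexWord 0 (S.flatten.map (↑)) ∈ wordsAbove (S.flatten.map (↑)) := by
  induction S with
  | nil => simp [genSchur, vertexWord_nil]
  | cons l S ih =>
    rw [List.flatten_cons, List.map_append]
    exact partOp_sub_mem l _ ih

/-! ### From words to Schur functions of partitions -/

theorem sum_rows {n : ℕ} (lam : n.Partition) : (rows lam).sum = n := by
  rw [rows, ← Multiset.sum_coe, Multiset.sort_eq, lam.parts_sum]

theorem exists_rows_eq {n : ℕ} {m : List ℕ} (hm : IsPartition m) (hs : m.sum = n) :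
    ∃ mu : n.Partition, rows mu = m := by
  refine ⟨⟨m, fun {i} hi => hm.2 i hi, by simpa using hs⟩, ?_⟩
  rw [rows]
  exact List.mergeSort_eq_self _ hm.1.pairwise

theorem mem_above {n : ℕ} {lam mu : n.Partition} : mu ∈ above lam ↔ DomLT lam mu := by
  simp [above]

theorem mem_below {n : ℕ} {lam mu : n.Partition} : mu ∈ below lam ↔ DomLT mu lam := by
  simp [below]

theorem wordsAbove_rows_le {n : ℕ} (lam : n.Partition) :
    wordsAbove ((rows lam).map (↑)) ≤
      Submodule.span intPoly (schur '' (above lam : Set n.Partition)) := by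
  refine Submodule.span_le.2 ?_
  rintro _ ⟨b, hb, hne, rfl⟩
  rcases vertexWord_zero_straighten b with h0 | ⟨m, hm, hsum, htake, hbm⟩
  · rw [h0]; exact Submodule.zero_mem _
  · have hs : m.sum = n := by
      have := hb.2.1
      rw [← Nat.cast_list_sum, sum_rows] at this
      omega
    obtain ⟨mu, rfl⟩ := exists_rows_eq hm hs
    have hmem : schur mu ∈ Submodule.span intPoly (schur '' (above lam : Set n.Partition)) := by
      refine Submodule.subset_span ⟨mu, mem_above.2 ⟨fun k => ?_, ?_⟩, rfl⟩
      · have h1 := (hb.2.2 k).trans (htake k)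
        rw [natCast_sum_take] at h1
        exact_mod_cast h1
      · rintro rfl
        -- If straightening b returned λ itself, then λ would dominate b, while b dominates λ.
        refine hne (SeqDom.antisymm ⟨hb.1.symm, hb.2.1.symm, fun k => ?_⟩ hb)
        rw [natCast_sum_take]
        exact htake k
    rcases hbm with e | e
    · rw [e]; exact hmem
    · rw [e]; exact Submodule.neg_mem _ hmem

theorem exists_coeff_of_mem_span {n : ℕ} {F : n.Partition → Sym} {s : Finset n.Partition}
    {f : Sym} (hf : f ∈ Submodule.span intPoly (F '' (s : Set _))) :
    ∃ K : n.Partition → ℤ[X], f = ∑ mu ∈ s, evalT (K mu) • F mu := by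
  obtain ⟨c, hc⟩ := (Submodule.mem_span_image_finset_iff_exists_fun' _).1 hf
  choose K hK using fun mu => (c mu).2
  refine ⟨K, hc.symm.trans (Finset.sum_congr rfl fun mu _ => ?_)⟩
  exact congrArg (fun x : Coef => x • F mu) (hK mu).symm

/-- Triangularity of generalized Schur products in the Schur basis. -/
theorem genSchur_sub_schur_mem {n : ℕ} (S : List (List ℕ)) (lam : n.Partition)
    (hS : S.flatten = rows lam) :
    genSchur S - schur lam ∈ Submodule.span intPoly (schur '' (above lam : Set n.Partition)) := by
  have h1 := genSchur_sub_mem S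
  rw [hS] at h1
  rw [schur, schurL_eq]
  exact wordsAbove_rows_le lam h1

/-! ### Orthogonal bases -/

theorem linearIndependent_of_hall {n : ℕ} {F G : n.Partition → Sym}
    (hne : ∀ mu nu, mu ≠ nu → hall (F mu) (G nu) = 0) (hself : ∀ mu, hall (F mu) (G mu) ≠ 0) :
    LinearIndependent Coef F := by
  rw [Fintype.linearIndependent_iff]
  intro g hg nu
  have h1 := congrArg (fun f => hall f (G nu)) hg
  simp only [map_sum, map_smul, LinearMap.sum_apply, LinearMap.smul_apply, map_zero,
    LinearMap.zero_apply] at h1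
  rw [Finset.sum_eq_single nu (fun mu _ hmu => by rw [hne mu nu hmu, smul_zero])
    (fun hnu => absurd (Finset.mem_univ nu) hnu), smul_eq_mul, mul_eq_zero] at h1
  exact h1.resolve_right (hself nu)

/-- A fixed index set U, allowed to be larger than the set of parts, lets the induction on the list
leave the outer product alone. -/
theorem normCoef_eq_prod (s : Coef) (a : List ℕ) {U : Finset ℕ} (hU : ∀ x ∈ a, x ∈ U) :
    normCoef s a = ∏ k ∈ U, ∏ j ∈ Finset.range (a.count k), (1 - s ^ (j + 1)) := by
  induction a with
  | nil => simp [normCoef]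
  | cons l a ih =>
    have hl : l ∈ U := hU l (by simp)
    rw [normCoef, ih fun x hx => hU x (by simp [hx]), ← Finset.mul_prod_erase U _ hl,
      ← Finset.mul_prod_erase U (fun k => ∏ j ∈ Finset.range ((l :: a).count k), _) hl,
      List.count_cons_self, Finset.prod_range_succ, ← mul_assoc,
      mul_comm (1 - s ^ (List.count l a + 1))]
    congr 1
    refine Finset.prod_congr rfl fun k hk => ?_
    rw [List.count_cons_of_ne (Finset.ne_of_mem_erase hk).symm]

theorem normCoef_zero (a : List ℕ) : normCoef 0 a = 1 := by
  rw [normCoef_eq_prod 0 a (U := a.toFinset) fun x hx => List.mem_toFinset.2 hx]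
  simp

theorem normCoef_rows {n : ℕ} (lam : n.Partition) : normCoef t (rows lam) = bCoef lam := by
  rw [normCoef_eq_prod t (rows lam) (U := lam.parts.toFinset)
    fun x hx => Multiset.mem_toFinset.2 ((Multiset.mem_sort _).1 hx), bCoef]
  refine Finset.prod_congr rfl fun k _ => ?_
  rw [rows, ← Multiset.coe_count, Multiset.sort_eq]

theorem one_sub_t_pow_ne_zero {k : ℕ} (hk : 0 < k) : (1 : Coef) - t ^ k ≠ 0 := by
  have h1 : (1 : Coef) - t ^ k = algebraMap (Polynomial ℚ) Coef (1 - Polynomial.X ^ k) := by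
    rw [map_sub, map_one, map_pow, RatFunc.algebraMap_X]; rfl
  rw [h1, Ne, FaithfulSMul.algebraMap_eq_zero_iff, sub_eq_zero]
  intro e
  have h2 := congrArg Polynomial.natDegree e
  rw [Polynomial.natDegree_one, Polynomial.natDegree_X_pow] at h2
  omega

theorem bCoef_ne_zero {n : ℕ} (lam : n.Partition) : bCoef lam ≠ 0 :=
  Finset.prod_ne_zero_iff.2 fun _ _ => Finset.prod_ne_zero_iff.2 fun j _ =>
    one_sub_t_pow_ne_zero j.succ_pos

theorem rows_ne {n : ℕ} {lam mu : n.Partition} (hne : lam ≠ mu) : rows lam ≠ rows mu :=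
  fun e => hne (rows_injective e)

theorem pleth_oneSub_zero (f : Sym) : pleth (oneSub 0) f = f := by
  have : pleth (oneSub 0) = AlgHom.id Coef Sym := by
    refine MvPolynomial.algHom_ext fun k => ?_
    simp [pleth, oneSub, p]
  rw [this]; rfl

theorem hall_schur_self {n : ℕ} (lam : n.Partition) : hall (schur lam) (schur lam) = 1 := by
  have h1 := hall_pleth_vertexPart_self 0 (isPartition_rows lam)
  rwa [pleth_oneSub_zero, normCoef_zero, ← schurL_eq] at h1

theorem hall_schur_of_ne {n : ℕ} {lam mu : n.Partition} (hne : lam ≠ mu) :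
    hall (schur lam) (schur mu) = 0 := by
  have h1 := hall_pleth_vertexPart_of_ne 0 (isPartition_rows lam) (isPartition_rows mu) (rows_ne hne)
  rwa [pleth_oneSub_zero, ← schurL_eq, ← schurL_eq] at h1

theorem linearIndependent_schur {n : ℕ} : LinearIndependent Coef (schur (n := n)) :=
  linearIndependent_of_hall (fun _ _ => hall_schur_of_ne) fun mu => by
    rw [hall_schur_self]; exact one_ne_zero

/-- `B_{μ_1} ⋯ B_{μ_m} 1`. -/
def jing {n : ℕ} (mu : n.Partition) : Sym := vertexPart t (rows mu)

/-- `f[X(1-t)]` for `f = B_{μ_1} ⋯ B_{μ_m} 1`. -/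
def jingQ {n : ℕ} (mu : n.Partition) : Sym := pleth (oneSub t) (jing mu)

theorem hall_jingQ_jing_self {n : ℕ} (mu : n.Partition) : hall (jingQ mu) (jing mu) = bCoef mu := by
  rw [← normCoef_rows]
  exact hall_pleth_vertexPart_self t (isPartition_rows mu)

theorem hall_jingQ_jing_of_ne {n : ℕ} {lam mu : n.Partition} (hne : lam ≠ mu) :
    hall (jingQ lam) (jing mu) = 0 :=
  hall_pleth_vertexPart_of_ne t (isPartition_rows lam) (isPartition_rows mu) (rows_ne hne)

theorem linearIndependent_jingQ {n : ℕ} : LinearIndependent Coef (jingQ (n := n)) :=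
  linearIndependent_of_hall (fun _ _ => hall_jingQ_jing_of_ne) fun mu => by
    rw [hall_jingQ_jing_self]; exact bCoef_ne_zero mu

theorem linearIndependent_jing {n : ℕ} : LinearIndependent Coef (jing (n := n)) :=
  linearIndependent_of_hall (G := jingQ)
    (fun mu nu hne => by rw [hall_comm, hall_jingQ_jing_of_ne hne.symm]) fun mu => by
    rw [hall_comm, hall_jingQ_jing_self]; exact bCoef_ne_zero mu

theorem partOp_singleton (l : ℕ) (f : Sym) : partOp [l] f = vertex t l f := by
  have e : (Finset.univ.filter fun x : Fin [l].length × Fin [l].length => x.1 < x.2) = ∅ := by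
    refine Finset.filter_eq_empty_iff.2 fun x _ hx => ?_
    have h1 : x.1.val < x.2.val := hx
    have h2 : x.2.val < 1 := x.2.2
    omega
  rw [partOp, e, Finset.powerset_empty, Finset.sum_singleton, ← vertexOp_eq]
  simp [vertexOps]

theorem genSchur_singletons (a : List ℕ) : genSchur (a.map fun x => [x]) = vertexPart t a := by
  induction a with
  | nil => rfl
  | cons l a ih => rw [List.map_cons, genSchur, ih, partOp_singleton, vertexPart_cons]

theorem jing_sub_schur_mem {n : ℕ} (lam : n.Partition) :
    jing lam - schur lam ∈ Submodule.span intPoly (schur '' (above lam : Set n.Partition)) := by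
  have h1 := genSchur_sub_schur_mem ((rows lam).map fun x => [x]) lam (by
    rw [← List.flatMap_def, List.flatMap_singleton'])
  rwa [genSchur_singletons] at h1

theorem hall_schur_jing_self {n : ℕ} (lam : n.Partition) : hall (schur lam) (jing lam) = 1 := by
  obtain ⟨K, hK⟩ := exists_coeff_of_mem_span (jing_sub_schur_mem lam)
  rw [sub_eq_iff_eq_add] at hK
  rw [hK, map_add, hall_schur_self, map_sum, Finset.sum_eq_zero, zero_add]
  intro mu hmu
  rw [map_smul, hall_schur_of_ne (mem_above.1 hmu).2, smul_zero]

theorem hall_schur_jing_of_not_le {n : ℕ} {lam mu : n.Partition} (hle : ¬ DomLE mu lam) :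
    hall (schur lam) (jing mu) = 0 := by
  obtain ⟨K, hK⟩ := exists_coeff_of_mem_span (jing_sub_schur_mem mu)
  rw [sub_eq_iff_eq_add] at hK
  have hne : lam ≠ mu := by
    rintro rfl
    exact hle fun _ => le_rfl
  rw [hK, map_add, hall_schur_of_ne hne, map_sum, Finset.sum_eq_zero, zero_add]
  intro nu hnu
  have hne' : lam ≠ nu := by
    rintro rfl
    exact hle (mem_above.1 hnu).1
  rw [map_smul, hall_schur_of_ne hne', smul_zero]

/-! ### Homogeneous components -/

/-- The symmetric functions of degree `n`. -/
def homog (n : ℕ) : Submodule Coef Sym :=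
  MvPolynomial.weightedHomogeneousSubmodule Coef (fun k : ℕ+ => (k : ℕ)) n

theorem schur_mem_homog {n : ℕ} (lam : n.Partition) : schur lam ∈ homog n := by
  rw [schur, schurL, Matrix.det_apply]
  refine Submodule.sum_mem _ fun σ _ => ?_
  rw [Units.smul_def]
  refine zsmul_mem ?_ _
  simp only [Matrix.of_apply]
  by_cases hneg : ∃ i, ((rows lam).get (σ i) : ℤ) + (i : ℤ) - (σ i : ℤ) < 0
  · obtain ⟨i, hi⟩ := hneg
    -- A negative index kills the term; otherwise the degrees add up to n, because the shifts i -
    -- σ(i) cancel.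
    rw [Finset.prod_eq_zero (Finset.mem_univ i) (h_of_neg hi)]
    exact Submodule.zero_mem _
  · push Not at hneg
    choose d hd using fun i => Int.eq_ofNat_of_zero_le (hneg i)
    have h1 : ∀ i ∈ Finset.univ, MvPolynomial.IsWeightedHomogeneous (fun k : ℕ+ => (k : ℕ))
        (h (((rows lam).get (σ i) : ℤ) + (i : ℤ) - (σ i : ℤ))) (d i) := by
      intro i _
      rw [hd, h_natCast]
      have := isWeightedHomogeneous_pleth_hNat (oneSub 0) (d i)
      rwa [pleth_oneSub_zero] at this
    have h2 := MvPolynomial.IsWeightedHomogeneous.prod Finset.univ _ d h1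
    have h3 : ∑ i, d i = n := by
      have e1 : ∑ i, ((rows lam).get (σ i) : ℤ) = ∑ i, ((rows lam).get i : ℤ) :=
        Equiv.sum_comp σ fun i => ((rows lam).get i : ℤ)
      have e2 : ∑ i, (σ i : ℤ) = ∑ i : Fin (rows lam).length, (i : ℤ) :=
        Equiv.sum_comp σ fun i => (i : ℤ)
      have e3 : ∑ i, (d i : ℤ) = n := by
        rw [← Finset.sum_congr rfl fun i _ => hd i, Finset.sum_sub_distrib,
          Finset.sum_add_distrib, e1, e2, add_sub_cancel_right, ← Nat.cast_sum,
          ← List.sum_ofFn, List.ofFn_get, sum_rows]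
      exact_mod_cast e3
    rw [h3] at h2
    exact h2

theorem pleth_mem_homog (c : ℕ+ → Coef) {n : ℕ} {f : Sym} (hf : f ∈ homog n) :
    pleth c f ∈ homog n := by
  rw [f.as_sum, map_sum]
  refine Submodule.sum_mem _ fun m hm => ?_
  rw [monomial_eq_smul_pMon, map_smul, pleth_pMon]
  refine Submodule.smul_mem _ _ (Submodule.smul_mem _ _ ?_)
  exact MvPolynomial.isWeightedHomogeneous_monomial _ _ _
    (hf (MvPolynomial.mem_support_iff.1 hm))

theorem jing_mem_homog {n : ℕ} (lam : n.Partition) : jing lam ∈ homog n := by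
  obtain ⟨K, hK⟩ := exists_coeff_of_mem_span (jing_sub_schur_mem lam)
  rw [sub_eq_iff_eq_add] at hK
  rw [hK]
  exact add_mem (Submodule.sum_mem _ fun mu _ => Submodule.smul_mem _ _ (schur_mem_homog mu))
    (schur_mem_homog lam)

theorem sum_toMultiset (m : ℕ+ →₀ ℕ) : ((Finsupp.toMultiset m).map fun k : ℕ+ => (k : ℕ)).sum =
    Finsupp.weight (fun k : ℕ+ => (k : ℕ)) m := by
  induction m using Finsupp.induction_linear with
  | zero => simp
  | add f g hf hg => rw [map_add, Multiset.map_add, Multiset.sum_add, hf, hg, map_add]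
  | single k a =>
    rw [Finsupp.toMultiset_single, Multiset.map_nsmul, Multiset.sum_nsmul, Finsupp.weight_single]
    simp

/-- The partition with `m_k` parts equal to `k`. -/
def partitionOfExp {n : ℕ} (m : {m : ℕ+ →₀ ℕ // Finsupp.weight (fun k : ℕ+ => (k : ℕ)) m = n}) :
    n.Partition where
  parts := (Finsupp.toMultiset m.1).map fun k : ℕ+ => (k : ℕ)
  parts_pos := fun {i} hi => by
    obtain ⟨k, -, rfl⟩ := Multiset.mem_map.1 hi
    exact k.pos
  parts_sum := (sum_toMultiset m.1).trans m.2

theorem partitionOfExp_injective {n : ℕ} : Function.Injective (partitionOfExp (n := n)) := by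
  intro a b hab
  have h1 := congrArg Nat.Partition.parts hab
  exact Subtype.ext (Multiset.toFinsupp.symm.injective
    (Multiset.map_injective PNat.coe_injective h1))

/-- A dimension count: the independent family is indexed by partitions of n, and degree n is spanned
by power-sum monomials, whose exponents inject into those partitions. -/
theorem span_jingQ (n : ℕ) : Submodule.span Coef (Set.range (jingQ (n := n))) = homog n := by
  let E := {m : ℕ+ →₀ ℕ // Finsupp.weight (fun k : ℕ+ => (k : ℕ)) m = n}
  have : Finite E := Finite.of_injective _ (partitionOfExp_injective (n := n))
  have := Fintype.ofFinite E
  let V := Submodule.span Coef (Set.range fun m : E => pMon m.1)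
  have hle : homog n ≤ V := by
    intro f hf
    rw [f.as_sum]
    refine Submodule.sum_mem _ fun m hm => ?_
    rw [monomial_eq_smul_pMon]
    exact Submodule.smul_mem _ _ (Submodule.subset_span
      ⟨⟨m, hf (MvPolynomial.mem_support_iff.1 hm)⟩, rfl⟩)
  have hle' : Submodule.span Coef (Set.range (jingQ (n := n))) ≤ homog n := by
    rw [Submodule.span_le]
    rintro _ ⟨mu, rfl⟩
    exact pleth_mem_homog _ (jing_mem_homog mu)
  have hV : Module.Finite Coef V := Module.Finite.span_of_finite Coef (Set.finite_range _)
  have heq : Submodule.span Coef (Set.range (jingQ (n := n))) = V := by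
    refine Submodule.eq_of_le_of_finrank_le (hle'.trans hle) ?_
    rw [finrank_span_eq_card linearIndependent_jingQ]
    exact (finrank_range_le_card _).trans
      (Fintype.card_le_of_injective _ (partitionOfExp_injective (n := n)))
  exact le_antisymm hle' (hle.trans heq.ge)

/-! ### Identification of the Hall–Littlewood polynomials -/

theorem pleth_pleth {c d : ℕ+ → Coef} (hcd : ∀ k, c k * d k = 1) (f : Sym) :
    pleth c (pleth d f) = f := by
  have : (pleth c).comp (pleth d) = AlgHom.id Coef Sym := by
    refine MvPolynomial.algHom_ext fun k => ?_
    have h1 : ∀ c : ℕ+ → Coef, pleth c (p k) = c k • p k := fun c => by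
      rw [pleth, p, MvPolynomial.aeval_X, MvPolynomial.smul_eq_C_mul]; rfl
    change pleth c (pleth d (p k)) = p k
    rw [h1, map_smul, h1, smul_smul, mul_comm, hcd, one_smul]
  exact congrArg (fun F => F f) this

/-- The substitution X(1-t) cancels the weights 1/(1 - t^k) of ⟨ , ⟩_t. -/
theorem scalarT_pleth (f g : Sym) : scalarT f (pleth (oneSub t) g) = hall f g := by
  rw [scalarT, ← hall_pleth, hall_pleth_right, pleth_pleth]
  intro k
  exact mul_one_div_cancel (one_sub_t_pow_ne_zero k.pos)

/-- Expand s_λ in the orthogonal family `jingQ`. The coefficient at μ is ⟨s_λ, jing μ⟩ / b_μ, which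
is zero unless μ ≤ λ and is 1/b_λ at μ = λ. By induction the recursion for P_λ subtracts exactly the
terms with μ < λ. -/
theorem hallLittlewoodP_eq_jingQ {n : ℕ} (lam : n.Partition) :
    hallLittlewoodP lam = (bCoef lam)⁻¹ • jingQ lam := by
  induction lam using domLT_wf.induction with
  | _ lam ih =>
    have hmem : schur lam ∈ Submodule.span Coef (Set.range (jingQ (n := n))) := by
      rw [span_jingQ]; exact schur_mem_homog lam
    obtain ⟨x, hx⟩ := (Submodule.mem_span_range_iff_exists_fun Coef).1 hmem
    have hxb : ∀ mu, hall (schur lam) (jing mu) = x mu * bCoef mu := fun mu => by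
      rw [← hx, map_sum, LinearMap.sum_apply, Finset.sum_eq_single_of_mem mu (Finset.mem_univ _)]
      · rw [map_smul, LinearMap.smul_apply, hall_jingQ_jing_self, smul_eq_mul]
      · intro nu _ hne
        rw [map_smul, LinearMap.smul_apply, hall_jingQ_jing_of_ne hne, smul_zero]
    have hlam : x lam = (bCoef lam)⁻¹ := by
      refine eq_inv_of_mul_eq_one_left ?_
      rw [← hxb, hall_schur_jing_self]
    have hbelow : ∀ mu ∈ below lam, (scalarT (schur lam) (hallLittlewoodP mu) /
        scalarT (hallLittlewoodP mu) (hallLittlewoodP mu)) • hallLittlewoodP mu =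
        x mu • jingQ mu := by
      intro mu hmu
      have hb := bCoef_ne_zero mu
      rw [ih mu (mem_below.1 hmu), smul_smul]
      congr 1
      simp only [map_smul, LinearMap.smul_apply, smul_eq_mul]
      rw [jingQ, scalarT_pleth, scalarT_pleth, ← jingQ, hall_jingQ_jing_self, hxb]
      field_simp
    have hsum : schur lam = x lam • jingQ lam + ∑ mu ∈ below lam, x mu • jingQ mu := by
      have hnot : lam ∉ below lam := fun hmem => (mem_below.1 hmem).2 rfl
      classical
      rw [← Finset.sum_insert (f := fun mu => x mu • jingQ mu) hnot, ← hx]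
      symm
      refine Finset.sum_subset (Finset.subset_univ _) fun mu _ hmu => ?_
      rw [Finset.mem_insert, not_or, mem_below] at hmu
      have h1 := hxb mu
      rw [hall_schur_jing_of_not_le (fun hle => hmu.2 ⟨hle, hmu.1⟩), eq_comm, mul_eq_zero] at h1
      rw [h1.resolve_right (bCoef_ne_zero mu), zero_smul]
    rw [hallLittlewoodP_eq, Finset.sum_congr rfl hbelow, hsum, add_sub_cancel_right, hlam]

theorem hallLittlewoodH_eq_jing {n : ℕ} (lam : n.Partition) : hallLittlewoodH lam = jing lam := by
  rw [hallLittlewoodH, hallLittlewoodQ, hallLittlewoodP_eq_jingQ, smul_smul,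
    mul_inv_cancel₀ (bCoef_ne_zero lam), one_smul, jingQ]
  exact pleth_pleth (fun k => one_div_mul_cancel (one_sub_t_pow_ne_zero k.pos)) _

/-! ### Unitriangular expansions -/

theorem exists_expansion {n : ℕ} {F : n.Partition → Sym} (hF : LinearIndependent Coef F)
    {lam : n.Partition} {f : Sym}
    (hf : f - F lam ∈ Submodule.span intPoly (F '' (above lam : Set n.Partition))) :
    ∃ K : n.Partition → ℤ[X],
      (∀ c : n.Partition → Coef, f = ∑ mu, c mu • F mu ↔ ∀ mu, c mu = evalT (K mu)) ∧
      K lam = 1 ∧ (∀ mu, ¬ DomLE lam mu → K mu = 0) ∧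
      f = F lam + ∑ mu ∈ above lam, evalT (K mu) • F mu := by
  classical
  obtain ⟨K₀, hK₀⟩ := exists_coeff_of_mem_span hf
  have hnot : lam ∉ above lam := fun hmem => (mem_above.1 hmem).2 rfl
  -- The span fixes coefficients only on partitions above λ, so the value 1 at λ and 0 elsewhere is
  -- imposed here.
  let K : n.Partition → ℤ[X] := fun mu =>
    if mu = lam then 1 else if mu ∈ above lam then K₀ mu else 0
  have hKlam : K lam = 1 := if_pos rfl
  have hKabove : ∀ mu ∈ above lam, K mu = K₀ mu := fun mu hmu => by
    have hne : mu ≠ lam := by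
      rintro rfl
      exact hnot hmu
    simp only [K]
    rw [if_neg hne, if_pos hmu]
  have hKzero : ∀ mu, mu ∉ insert lam (above lam) → K mu = 0 := fun mu hmu => by
    rw [Finset.mem_insert, not_or] at hmu
    simp only [K]
    rw [if_neg hmu.1, if_neg hmu.2]
  have hf1 : f = F lam + ∑ mu ∈ above lam, evalT (K mu) • F mu := by
    rw [Finset.sum_congr rfl fun mu hmu => by rw [hKabove mu hmu], ← hK₀, add_sub_cancel]
  have hf2 : f = ∑ mu, evalT (K mu) • F mu := by
    have e : F lam = evalT (K lam) • F lam := by rw [hKlam, evalT, map_one, one_smul]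
    rw [hf1]
    conv_lhs => rw [e]
    rw [← Finset.sum_insert (f := fun mu => evalT (K mu) • F mu) hnot]
    refine Finset.sum_subset (Finset.subset_univ _) fun mu _ hmu => ?_
    rw [hKzero mu hmu, evalT, map_zero, zero_smul]
  refine ⟨K, fun c => ⟨fun hc mu => ?_, fun hc => ?_⟩, hKlam, fun mu hmu => hKzero mu ?_, hf1⟩
  · rw [hf2] at hc
    exact (Fintype.linearIndependent_iffₛ.1 hF _ _ hc mu).symm
  · rw [hf2]
    exact Finset.sum_congr rfl fun mu _ => by rw [hc]
  · rw [Finset.mem_insert, not_or, mem_above]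
    exact ⟨fun e => hmu (e ▸ fun _ => le_rfl), fun hlt => hmu hlt.1⟩

theorem DomLE.trans {n : ℕ} {lam mu nu : n.Partition} (h₁ : DomLE lam mu) (h₂ : DomLE mu nu) :
    DomLE lam nu := fun i => (h₁ i).trans (h₂ i)

theorem above_subset {n : ℕ} {lam mu : n.Partition} (hmu : mu ∈ above lam) :
    above mu ⊆ above lam := fun nu hnu => by
  rw [mem_above] at *
  refine ⟨hmu.1.trans hnu.1, ?_⟩
  rintro rfl
  exact hnu.2 (hnu.1.antisymm hmu.1)

/-- A unitriangular change of basis over `ℤ[t]`. -/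
theorem span_above_le {n : ℕ} {F G : n.Partition → Sym}
    (hFG : ∀ mu, G mu - F mu ∈ Submodule.span intPoly (F '' (above mu : Set n.Partition)))
    (lam : n.Partition) :
    Submodule.span intPoly (F '' (above lam : Set n.Partition)) ≤
      Submodule.span intPoly (G '' (above lam : Set n.Partition)) := by
  -- Induction runs downwards from the maximal partitions, where nothing lies above.
  have hwf : WellFounded fun a b : n.Partition => DomLT b a := by
    have : IsTrans n.Partition fun a b => DomLT b a := ⟨fun a b c hab hbc =>
      ⟨hbc.1.trans hab.1, fun e => hab.2 (hab.1.antisymm (e ▸ hbc.1))⟩⟩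
    have : Std.Irrefl fun a b : n.Partition => DomLT b a := ⟨fun a h => h.2 rfl⟩
    exact Finite.wellFounded_of_trans_of_irrefl _
  induction lam using hwf.induction with
  | _ lam ih =>
    refine Submodule.span_le.2 ?_
    rintro _ ⟨mu, hmu, rfl⟩
    have hmu' : mu ∈ above lam := hmu
    -- For μ > λ, F μ = G μ - (G μ - F μ), and the difference lies in the span of the G above μ by
    -- induction.
    have h1 := ih mu (mem_above.1 hmu') (hFG mu)
    have h2 : Submodule.span intPoly (G '' (above mu : Set n.Partition)) ≤
        Submodule.span intPoly (G '' (above lam : Set n.Partition)) :=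
      Submodule.span_mono (Set.image_mono (Finset.coe_subset.2 (above_subset hmu')))
    have h3 : G mu ∈ Submodule.span intPoly (G '' (above lam : Set n.Partition)) :=
      Submodule.subset_span ⟨mu, hmu, rfl⟩
    have h4 := sub_mem h3 (h2 h1)
    rwa [sub_sub_cancel] at h4

theorem genSchur_sub_hallLittlewoodH_mem {n : ℕ} (S : List (List ℕ)) (lam : n.Partition)
    (hS : S.flatten = rows lam) : genSchur S - hallLittlewoodH lam ∈
      Submodule.span intPoly (hallLittlewoodH '' (above lam : Set n.Partition)) := by
  have hFG : ∀ mu : n.Partition, hallLittlewoodH mu - schur mu ∈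
      Submodule.span intPoly (schur '' (above mu : Set n.Partition)) := fun mu => by
    rw [hallLittlewoodH_eq_jing]
    exact jing_sub_schur_mem mu
  -- The product and H_λ have the same leading term s_λ, so their difference lies in the span of the
  -- Schur functions above λ, where the basis can be changed.
  have h1 := span_above_le hFG lam (sub_mem (genSchur_sub_schur_mem S lam hS) (hFG lam))
  rwa [sub_sub_sub_cancel_right] at h1

theorem linearIndependent_hallLittlewoodH {n : ℕ} :
    LinearIndependent Coef (hallLittlewoodH (n := n)) := by
  rw [funext (hallLittlewoodH_eq_jing (n := n))]
  exact linearIndependent_jing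

end GenSchur

end

theorem mainTheorem9 (S : List (List ℕ)) (hS : ∀ l ∈ S, GenSchur.IsPartition l)
    (n : ℕ) (lam : n.Partition) (hdom : S.flatten = GenSchur.rows lam) :
    (∃ K : n.Partition → Polynomial ℤ,
      (∀ c : n.Partition → GenSchur.Coef,
        GenSchur.genSchur S = ∑ mu, c mu • GenSchur.schur mu ↔
          ∀ mu, c mu = GenSchur.evalT (K mu)) ∧
      K lam = 1 ∧
      (∀ mu, ¬ GenSchur.DomLE lam mu → K mu = 0) ∧
      GenSchur.genSchur S = GenSchur.schur lam +
        ∑ mu ∈ GenSchur.above lam, GenSchur.evalT (K mu) • GenSchur.schur mu) ∧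
    (∃ C : n.Partition → Polynomial ℤ,
      (∀ c : n.Partition → GenSchur.Coef,
        GenSchur.genSchur S = ∑ mu, c mu • GenSchur.hallLittlewoodH mu ↔
          ∀ mu, c mu = GenSchur.evalT (C mu)) ∧
      C lam = 1 ∧
      (∀ mu, ¬ GenSchur.DomLE lam mu → C mu = 0) ∧
      GenSchur.genSchur S = GenSchur.hallLittlewoodH lam +
        ∑ mu ∈ GenSchur.above lam, GenSchur.evalT (C mu) • GenSchur.hallLittlewoodH mu) :=
  ⟨GenSchur.exists_expansion GenSchur.linearIndependent_schur
      (GenSchur.genSchur_sub_schur_mem S lam hdom),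
    GenSchur.exists_expansion GenSchur.linearIndependent_hallLittlewoodH
      (GenSchur.genSchur_sub_hallLittlewoodH_mem S lam hdom)⟩
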